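/- **Theorem 3.1 (Local well-posedness).** For $s\in\mathbb R$ let $H^s(\mathbb R)$ be the Sobolev space of complex-valued functions, with norm $\|u\|_{H^s}=\|(1+|\xi|^2)^{s/2}\,\widehat u\,\|_{L^2}$, where $\widehat u(\xi)=\int e^{-2\pi i x\xi}u(x)\,dx$. Consider the initial value problem for the fifth-order BBM equation with real coefficients $\gamma_1,\gamma_2,\delta_1,\delta_2,\gamma$, $$\partial_t\eta+\partial_x\eta-\gamma_1\partial_x^2\partial_t\eta+\gamma_2\partial_x^3\eta+\delta_1\partial_x^4\partial_t\eta+\delta_2\partial_x^5\eta+\tfrac34\partial_x(\eta^2)+\gamma\,\partial_x^3(\eta^2)-\tfrac7{48}\partial_x\big((\partial_x\eta)^2\big)-\tfrac18\partial_x(\eta^3)=0,\qquad \eta(\cdot,0)=\eta_0 .$$ For $T>0$, a solution on $[0,T]$ with initial value $\eta_0\in H^s(\mathbb R)$ is a function $\eta\in C([0,T];H^s(\mathbb R))$ with $\eta(0)=\eta_0$ that satisfies the equation in the sense of distributions on $(0,T)\times\mathbb R$, that is, when tested against all products $\chi(t)\varphi(x)$ with $\chi\in C_c^\infty((0,T))$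 and $\varphi$ a Schwartz function. Let $\gamma_1>0$, $\delta_1>0$ and $s\ge 1$. There is a constant $C>0$, depending only on $s,\gamma_1,\delta_1,\gamma$, such that for all real $\gamma_2,\delta_2$, every $\eta_0\in H^s(\mathbb R)$ and every $T>0$ with $$8\,C\,\|\eta_0\|_{H^s}\,(1+\|\eta_0\|_{H^s})\,T\le 1$$ (so, for $\eta_0\ne0$, in particular for $T=\frac{1}{8C\|\eta_0\|_{H^s}(1+\|\eta_0\|_{H^s})}$, which depends on $\eta_0$ only through its norm; for $\eta_0=0$, for every $T>0$) the following hold. 1. There is exactly one solution $\eta\in C([0,T];H^s(\mathbb R))$ on $[0,T]$ with initial value $\eta_0$. 2. It satisfies $\|\eta(t)\|_{H^s}\le 2\|\eta_0\|_{H^s}$ for all $t\in[0,T]$. If $\eta_0$ is real-valued almost everywhere, so is $\eta(t)$ for every $t\in[0,T]$. 3. The solution depends continuously on the initial value: there is a neighbourhood $U$ of $\eta_0$ in $H^s(\mathbb R)$ such that every $\zeta_0\in U$ is the initial value of exactly one solution $\zeta\in C([0,T];H^s(\mathbb R))$ on $[0,T]$, and the map $\zeta_0\mapsto\zeta$ from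 $U$ to $C([0,T];H^s(\mathbb R))$ is continuous. -/

import Mathlib

open MeasureTheory Topology
open scoped SchwartzMap ENNReal ContDiff

noncomputable section

namespace FifthOrderBBM

/-- The Sobolev functions of order `s` on the line, as a subspace of the tempered distributions. -/
def sobolevSubmodule (s : ℝ) : Submodule ℂ 𝓢'(ℝ, ℂ) where
  carrier := {F | TemperedDistribution.MemSobolev s 2 F}
  add_mem' hf hg := TemperedDistribution.MemSobolev.add hf hg
  zero_mem' := TemperedDistribution.memSobolev_fun_zero ℝ ℂ s 2
  smul_mem' c _ hf := TemperedDistribution.MemSobolev.smul c hf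

/-- The space `H^s(ℝ)` of complex-valued Sobolev functions. It is a type of its own, so that it
carries the `H^s` norm below and not the topology induced by the tempered distributions. -/
def Hs (s : ℝ) : Type := ↥(sobolevSubmodule s)

namespace Hs

variable {s : ℝ}

instance : AddCommGroup (Hs s) := inferInstanceAs (AddCommGroup ↥(sobolevSubmodule s))

instance : Module ℂ (Hs s) := inferInstanceAs (Module ℂ ↥(sobolevSubmodule s))

/-- The inclusion of `H^s(ℝ)` into the tempered distributions. -/
def toDist : Hs s →ₗ[ℂ] 𝓢'(ℝ, ℂ) := (sobolevSubmodule s).subtype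

theorem toDist_injective : Function.Injective (toDist (s := s)) :=
  Subtype.val_injective

theorem memSobolev_toDist (u : Hs s) : TemperedDistribution.MemSobolev s 2 (toDist u) :=
  u.2

/-- An `L²` function is determined by the tempered distribution that it defines. -/
theorem lp_toDist_injective {f g : Lp ℂ 2 (volume : Measure ℝ)}
    (h : (f : 𝓢'(ℝ, ℂ)) = (g : 𝓢'(ℝ, ℂ))) : f = g := by
  have hk := Lp.ker_toTemperedDistributionCLM_eq_bot (F := ℂ) (μ := (volume : Measure ℝ)) (p := 2)
  exact LinearMap.ker_eq_bot.1 hk h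

/-- The `L²` function `(1 + |D|²)^{s/2} u`, that is, the one whose Fourier transform
`∫ e^{-2πixξ} · dx` is `(1 + |ξ|²)^{s/2}` times that of `u`. -/
def besselLp (u : Hs s) : Lp ℂ 2 (volume : Measure ℝ) := (memSobolev_toDist u).choose

theorem besselLp_spec (u : Hs s) :
    TemperedDistribution.besselPotential ℝ ℂ s (toDist u) = (besselLp u : 𝓢'(ℝ, ℂ)) :=
  (memSobolev_toDist u).choose_spec

/-- `besselLp` as a linear map. -/
def toLp : Hs s →ₗ[ℂ] Lp ℂ 2 (volume : Measure ℝ) where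
  toFun := besselLp
  map_add' u v := by
    apply lp_toDist_injective
    rw [← besselLp_spec, ← Lp.toTemperedDistributionCLM_apply, map_add, map_add, map_add,
      besselLp_spec, besselLp_spec, Lp.toTemperedDistributionCLM_apply,
      Lp.toTemperedDistributionCLM_apply]
  map_smul' c u := by
    apply lp_toDist_injective
    rw [← besselLp_spec, ← Lp.toTemperedDistributionCLM_apply]
    simp [besselLp_spec]

theorem toLp_injective : Function.Injective (toLp (s := s)) := by
  intro u v h
  apply toDist_injective
  have h' : besselLp u = besselLp v := h
  have e : TemperedDistribution.besselPotential ℝ ℂ s (toDist u) =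
      TemperedDistribution.besselPotential ℝ ℂ s (toDist v) := by
    rw [besselLp_spec, besselLp_spec, h']
  have e2 := congrArg (TemperedDistribution.besselPotential ℝ ℂ (-s)) e
  simpa using e2

/-- The norm of `H^s(ℝ)`: `‖u‖ = ‖(1 + |D|²)^{s/2} u‖_{L²} = ‖(1 + |ξ|²)^{s/2} û‖_{L²}`. -/
instance : NormedAddCommGroup (Hs s) :=
  NormedAddCommGroup.induced (Hs s) (Lp ℂ 2 (volume : Measure ℝ)) toLp toLp_injective

instance : NormedSpace ℂ (Hs s) :=
  NormedSpace.induced ℂ (Hs s) (Lp ℂ 2 (volume : Measure ℝ)) toLp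

end Hs

/-- The derivative `∂ₓ` of tempered distributions on the line. -/
abbrev dx : 𝓢'(ℝ, ℂ) →L[ℂ] 𝓢'(ℝ, ℂ) := TemperedDistribution.derivCLM ℂ

open Classical in
/-- The function (unique up to null sets) that represents a tempered distribution belonging to
`L²(ℝ)`; the zero function for all other distributions. -/
def l2Fun (F : 𝓢'(ℝ, ℂ)) : ℝ → ℂ :=
  if h : ∃ f : Lp ℂ 2 (volume : Measure ℝ), F = (f : 𝓢'(ℝ, ℂ)) then h.choose else 0

open Classical in
/-- The tempered distribution `φ ↦ ∫ f φ` of an integrable function `f`; zero for other `f`.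
It is applied below to `u²`, `u³` and `(∂ₓ u)²` with `u` in `H^s(ℝ)`, `s ≥ 1`, and these are
integrable because `u` is bounded and `u`, `∂ₓ u` are square integrable. -/
def ofL1 (f : ℝ → ℂ) : 𝓢'(ℝ, ℂ) :=
  if h : MemLp f 1 (volume : Measure ℝ) then ((h.toLp f : Lp ℂ 1 (volume : Measure ℝ)) : 𝓢'(ℝ, ℂ))
  else 0

/-- The expression under the time derivative: `u - γ₁ ∂ₓ² u + δ₁ ∂ₓ⁴ u`. -/
def timeTerm (γ₁ δ₁ : ℝ) (u : 𝓢'(ℝ, ℂ)) : 𝓢'(ℝ, ℂ) :=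
  u - (γ₁ : ℂ) • (dx ^ 2) u + (δ₁ : ℂ) • (dx ^ 4) u

/-- The terms of the equation without time derivative:
`∂ₓ u + γ₂ ∂ₓ³ u + δ₂ ∂ₓ⁵ u + (3/4) ∂ₓ(u²) + γ ∂ₓ³(u²) - (7/48) ∂ₓ((∂ₓ u)²) - (1/8) ∂ₓ(u³)`. -/
def spaceTerm (γ₂ δ₂ γ : ℝ) (u : 𝓢'(ℝ, ℂ)) : 𝓢'(ℝ, ℂ) :=
  dx u + (γ₂ : ℂ) • (dx ^ 3) u + (δ₂ : ℂ) • (dx ^ 5) u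
    + (3 / 4 : ℂ) • dx (ofL1 fun x => l2Fun u x ^ 2)
    + (γ : ℂ) • (dx ^ 3) (ofL1 fun x => l2Fun u x ^ 2)
    - (7 / 48 : ℂ) • dx (ofL1 fun x => l2Fun (dx u) x ^ 2)
    - (1 / 8 : ℂ) • dx (ofL1 fun x => l2Fun u x ^ 3)

/-- `η ∈ C([0,T]; H^s)` solves the initial value problem for the fifth-order BBM equation
`∂ₜη + ∂ₓη - γ₁∂ₓ²∂ₜη + γ₂∂ₓ³η + δ₁∂ₓ⁴∂ₜη + δ₂∂ₓ⁵η
  + (3/4)∂ₓ(η²) + γ∂ₓ³(η²) - (7/48)∂ₓ((∂ₓη)²) - (1/8)∂ₓ(η³) = 0`, `η(0) = η₀`: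
the initial value is attained, and the equation holds in the sense of distributions on
`(0,T) × ℝ`, tested against the products `χ(t) φ(x)` with `χ` smooth and compactly supported
in `(0,T)` and `φ` a Schwartz function. (`Set.IccExtend` only makes `η` a function on `ℝ`, so that
it can be put under the integral over `[0,T]`.) -/
structure IsSolution (γ₁ γ₂ δ₁ δ₂ γ : ℝ) {s T : ℝ} (hT : 0 < T) (η₀ : Hs s)
    (η : C(Set.Icc (0 : ℝ) T, Hs s)) : Prop where
  initial : η ⟨0, Set.left_mem_Icc.2 hT.le⟩ = η₀
  equation : ∀ χ : ℝ → ℝ, ContDiff ℝ ∞ χ → HasCompactSupport χ → tsupport χ ⊆ Set.Ioo 0 T →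
    ∀ φ : 𝓢(ℝ, ℂ),
      -(∫ t in (0 : ℝ)..T,
          ((deriv χ t : ℝ) : ℂ) * timeTerm γ₁ δ₁ (Hs.toDist (Set.IccExtend hT.le η t)) φ)
        + ∫ t in (0 : ℝ)..T,
          ((χ t : ℝ) : ℂ) * spaceTerm γ₂ δ₂ γ (Hs.toDist (Set.IccExtend hT.le η t)) φ = 0

/-- `u` is real-valued almost everywhere (meaningful for `s ≥ 0`, where `u` is in `L²`). -/
def IsReal {s : ℝ} (u : Hs s) : Prop :=
  ∀ᵐ x : ℝ, (l2Fun (Hs.toDist u) x).im = 0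

end FifthOrderBBM

end

/-! On the Fourier side the equation is an ordinary differential equation in `L²`. Put g =
(1+|ξ|²)^{s/2} η̂. Dividing by the symbol 1 + γ₁(2πξ)² + δ₁(2πξ)⁴, which is at least 1, turns the
equation into g' = -iφ(ξ) g + N(g), with the real phase φ given by `phase` and N a sum of bounded
bilinear and trilinear expressions. The phase grows linearly in general, so the linear part is not
bounded on `L²`; but e^{itφ} is unitary, and v = e^{itφ} g solves v' = e^{itφ} N(e^{-itφ} v), whose
right side is Lipschitz on balls. Picard–Lindelöf gives existence, Grönwall gives uniqueness and
Lipschitz dependence on the data. Since γ₂ and δ₂ enter only through φ, and the propagator preserves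
norms, the constant does not see them.

Boundedness of N: the elliptic symbol has order four and the nonlinear terms carry at most three
derivatives, so one power of the weight is gained. After Peetre's inequality the kernel for u² is
bounded by (1+|ζ|²)^{-1/2}, which is square integrable on the line, and Cauchy–Schwarz suffices
(`isBilinKernel_of_le_left`). The term (∂ₓu)² loses a derivative in each factor but carries only one
outside; there the decay survives in the output variable (`isBilinKernel_of_le_right`). The cubic
term is u times u², with u² controlled in the weight of order s-1.

The bridge to distributions is `isSolution_iff`. Every Schwartz function is some 𝓕ψ, and testing
with 𝓕ψ becomes an `L²` pairing of g with explicit multiples of ψ (`timeTerm_apply_fourier`,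
`spaceTerm_apply_fourier`); products become convolutions by density of Schwartz functions. The lemma
of du Bois-Reymond turns the weak time derivative into an integral identity for each ψ. Testing with
e^{itφ}ψ, ψ of compact support, removes the linear part and yields the differential equation for v
(`mild_of_weak`); the converse is a product rule (`weak_of_mild`).

Real data stay real because conjugation in x becomes the operation f ↦ conj f(-·) on the Fourier
side. It commutes with the propagator, φ being odd, and with N, so uniqueness makes the solution
invariant. -/

noncomputable section

namespace FifthOrderBBM

/-! ### The weights `(1 + |ξ|²)^{a/2}` -/

/-- The weight `(1 + |ξ|²)^{a/2}`. -/
def bracket (a ξ : ℝ) : ℝ := (1 + ‖ξ‖ ^ 2) ^ (a / 2)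

theorem bracket_pos (a ξ : ℝ) : 0 < bracket a ξ := Real.rpow_pos_of_pos (by positivity) _

theorem bracket_mul (a b ξ : ℝ) : bracket a ξ * bracket b ξ = bracket (a + b) ξ := by
  rw [bracket, bracket, bracket, ← Real.rpow_add (by positivity)]
  congr 1
  ring

@[simp] theorem bracket_zero (ξ : ℝ) : bracket 0 ξ = 1 := by simp [bracket]

theorem bracket_two (ξ : ℝ) : bracket 2 ξ = 1 + ξ ^ 2 := by simp [bracket]

theorem bracket_neg_eq (a ξ : ℝ) : bracket (-a) ξ = (bracket a ξ)⁻¹ := by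
  rw [bracket, bracket, ← Real.rpow_neg (by positivity)]
  congr 1
  ring

@[simp] theorem bracket_even (a ξ : ℝ) : bracket a (-ξ) = bracket a ξ := by simp [bracket]

theorem bracket_le_bracket {a b : ℝ} (h : a ≤ b) (ξ : ℝ) : bracket a ξ ≤ bracket b ξ :=
  Real.rpow_le_rpow_of_exponent_le (by nlinarith [sq_nonneg ‖ξ‖]) (by linarith)

theorem bracket_le_one {a : ℝ} (h : a ≤ 0) (ξ : ℝ) : bracket a ξ ≤ 1 := by
  simpa using bracket_le_bracket h ξ

theorem continuous_bracket (a : ℝ) : Continuous (bracket a) := by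
  unfold bracket
  exact Continuous.rpow_const (by fun_prop) fun x => Or.inl (by positivity)

theorem measurable_bracket (a : ℝ) : Measurable (bracket a) := (continuous_bracket a).measurable

theorem hasTemperateGrowth_bracket (a : ℝ) :
    (fun ξ : ℝ => ((bracket a ξ : ℝ) : ℂ)).HasTemperateGrowth := by
  unfold bracket
  fun_prop

/-- Peetre's inequality. -/
theorem bracket_le_mul {a : ℝ} (ha : 0 ≤ a) (ξ ζ : ℝ) :
    bracket a ξ ≤ 2 ^ (a / 2) * (bracket a ζ * bracket a (ξ - ζ)) := by
  unfold bracket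
  rw [← Real.mul_rpow (by positivity) (by positivity),
    ← Real.mul_rpow (by positivity) (by positivity)]
  apply Real.rpow_le_rpow (by positivity) _ (by positivity)
  simp only [Real.norm_eq_abs, sq_abs]
  -- The first square equals 2ζ² + 2(ξ-ζ)² - ξ²; the second term is the cross term of the product of
  -- the two weights.
  nlinarith [sq_nonneg (ξ - 2 * ζ), mul_nonneg (sq_nonneg ζ) (sq_nonneg (ξ - ζ))]

theorem abs_le_bracket_one (ξ : ℝ) : |ξ| ≤ bracket 1 ξ := by
  unfold bracket
  rw [← Real.sqrt_eq_rpow]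
  apply Real.le_sqrt_of_sq_le
  simp

theorem bracket_neg_one_sq (ξ : ℝ) : bracket (-1) ξ ^ 2 = (1 + ξ ^ 2)⁻¹ := by
  rw [sq, bracket_mul, ← bracket_two, ← bracket_neg_eq]
  norm_num

theorem lintegral_bracket_neg_one_sq_lt_top :
    ∫⁻ ξ : ℝ, ENNReal.ofReal (bracket (-1) ξ) ^ 2 < ⊤ := by
  have h := integrable_inv_one_add_sq.hasFiniteIntegral
  have h2 := (hasFiniteIntegral_iff_ofReal (Filter.Eventually.of_forall fun x : ℝ => by
    positivity : 0 ≤ᵐ[volume] fun x : ℝ => (1 + x ^ 2)⁻¹)).1 h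
  refine lt_of_le_of_lt (le_of_eq (lintegral_congr fun ξ => ?_)) h2
  rw [← ENNReal.ofReal_pow (bracket_pos _ _).le, bracket_neg_one_sq]

end FifthOrderBBM

end

noncomputable section

namespace FifthOrderBBM

/-! ### Bilinear operators given by kernels -/

/-- The space `L²(ℝ)` of complex-valued functions. -/
abbrev L2 : Type := Lp ℂ 2 (volume : Measure ℝ)

theorem sq_lintegral_mul_le {α : Type*} [MeasurableSpace α] {μ : Measure α} {f g : α → ℝ≥0∞}
    (hf : AEMeasurable f μ) (hg : AEMeasurable g μ) :
    (∫⁻ x, f x * g x ∂μ) ^ 2 ≤ (∫⁻ x, f x ^ 2 ∂μ) * ∫⁻ x, g x ^ 2 ∂μ := by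
  have h := ENNReal.lintegral_mul_le_Lp_mul_Lq μ Real.HolderConjugate.two_two hf hg
  have h2 := ENNReal.rpow_le_rpow h (z := 2) (by norm_num)
  rw [ENNReal.mul_rpow_of_nonneg _ _ (by norm_num), ← ENNReal.rpow_mul, ← ENNReal.rpow_mul] at h2
  simpa using h2

/-- The kernel `k` defines a bounded bilinear operator
`(f, g) ↦ ∫ k(·, ζ) f(ζ) g(· - ζ) dζ` on `L²`. -/
structure IsBilinKernel (k : ℝ → ℝ → ℂ) : Prop where
  measurable : Measurable (Function.uncurry k)
  bound : ∃ A : ℝ, 0 ≤ A ∧ ∀ f g : ℝ → ℝ≥0∞, Measurable f → Measurable g →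
    ∫⁻ ξ, (∫⁻ ζ, ‖k ξ ζ‖ₑ * (f ζ * g (ξ - ζ))) ^ 2 ≤
      ENNReal.ofReal A * ((∫⁻ ζ, f ζ ^ 2) * ∫⁻ ζ, g ζ ^ 2)

/-- Cauchy–Schwarz in ζ, with the square-integrable weight split off, leaves ∫ |f(ζ) g(ξ-ζ)|² dζ.
Tonelli and translation invariance factor its integral over ξ. -/
theorem isBilinKernel_of_le_left {k : ℝ → ℝ → ℂ} (hk : Measurable (Function.uncurry k)) {c : ℝ}
    (h : ∀ ξ ζ, ‖k ξ ζ‖ ≤ c * bracket (-1) ζ) : IsBilinKernel k := by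
  refine ⟨hk, (ENNReal.ofReal c ^ 2 * ∫⁻ ξ : ℝ, ENNReal.ofReal (bracket (-1) ξ) ^ 2).toReal,
    ENNReal.toReal_nonneg, fun f g hf hg => ?_⟩
  rw [ENNReal.ofReal_toReal (ENNReal.mul_ne_top (by finiteness)
    lintegral_bracket_neg_one_sq_lt_top.ne)]
  have hc : 0 ≤ c := by
    have := (norm_nonneg _).trans (h 0 0)
    exact nonneg_of_mul_nonneg_left this (bracket_pos _ _)
  set W := ∫⁻ ξ : ℝ, ENNReal.ofReal (bracket (-1) ξ) ^ 2
  have hb : Measurable fun ξ => ENNReal.ofReal (bracket (-1) ξ) :=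
    (measurable_bracket _).ennreal_ofReal
  have key : ∀ ξ, (∫⁻ ζ, ‖k ξ ζ‖ₑ * (f ζ * g (ξ - ζ))) ^ 2 ≤
      (ENNReal.ofReal c ^ 2 * W) * ∫⁻ ζ, (f ζ * g (ξ - ζ)) ^ 2 := by
    intro ξ
    have hm : Measurable fun ζ => f ζ * g (ξ - ζ) :=
      hf.mul (hg.comp (measurable_const.sub measurable_id))
    calc (∫⁻ ζ, ‖k ξ ζ‖ₑ * (f ζ * g (ξ - ζ))) ^ 2
        ≤ (∫⁻ ζ, (ENNReal.ofReal c * ENNReal.ofReal (bracket (-1) ζ)) * (f ζ * g (ξ - ζ))) ^ 2 := by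
          gcongr with ζ
          rw [← ENNReal.ofReal_mul hc, ← ofReal_norm]
          exact ENNReal.ofReal_le_ofReal (h ξ ζ)
      _ ≤ (∫⁻ ζ, (ENNReal.ofReal c * ENNReal.ofReal (bracket (-1) ζ)) ^ 2) *
          ∫⁻ ζ, (f ζ * g (ξ - ζ)) ^ 2 :=
          sq_lintegral_mul_le (hb.const_mul _).aemeasurable hm.aemeasurable
      _ = _ := by
          simp_rw [mul_pow (ENNReal.ofReal c)]
          rw [lintegral_const_mul _ (hb.pow_const 2)]
  have hm2 : Measurable fun p : ℝ × ℝ => (f p.2 * g (p.1 - p.2)) ^ 2 :=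
    ((hf.comp measurable_snd).mul (hg.comp (measurable_fst.sub measurable_snd))).pow_const 2
  calc ∫⁻ ξ, (∫⁻ ζ, ‖k ξ ζ‖ₑ * (f ζ * g (ξ - ζ))) ^ 2
      ≤ ∫⁻ ξ, (ENNReal.ofReal c ^ 2 * W) * ∫⁻ ζ, (f ζ * g (ξ - ζ)) ^ 2 := lintegral_mono key
    _ = (ENNReal.ofReal c ^ 2 * W) * ∫⁻ ξ, ∫⁻ ζ, (f ζ * g (ξ - ζ)) ^ 2 :=
        lintegral_const_mul _ hm2.lintegral_prod_right'
    _ = (ENNReal.ofReal c ^ 2 * W) * ∫⁻ ζ, ∫⁻ ξ, (f ζ * g (ξ - ζ)) ^ 2 := by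
        rw [lintegral_lintegral_swap hm2.aemeasurable]
    _ = (ENNReal.ofReal c ^ 2 * W) * ∫⁻ ζ, f ζ ^ 2 * ∫⁻ ξ, g ξ ^ 2 := by
        congr 1
        refine lintegral_congr fun ζ => ?_
        simp_rw [mul_pow]
        have hg' : Measurable fun ξ => g (ξ - ζ) := hg.comp (measurable_id.sub measurable_const)
        rw [lintegral_const_mul _ (hg'.pow_const 2)]
        congr 1
        exact lintegral_sub_right_eq_self (fun x => g x ^ 2) ζ
    _ = _ := by
        rw [lintegral_mul_const _ (hf.pow_const 2)]

/-- The convolution of two `L²` functions is bounded by the product of their norms, so it is enough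
that the weight in the output variable is square integrable. -/
theorem isBilinKernel_of_le_right {k : ℝ → ℝ → ℂ} (hk : Measurable (Function.uncurry k)) {c : ℝ}
    (h : ∀ ξ ζ, ‖k ξ ζ‖ ≤ c * bracket (-1) ξ) : IsBilinKernel k := by
  refine ⟨hk, (ENNReal.ofReal c ^ 2 * ∫⁻ ξ : ℝ, ENNReal.ofReal (bracket (-1) ξ) ^ 2).toReal,
    ENNReal.toReal_nonneg, fun f g hf hg => ?_⟩
  rw [ENNReal.ofReal_toReal (ENNReal.mul_ne_top (by finiteness)
    lintegral_bracket_neg_one_sq_lt_top.ne)]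
  have hc : 0 ≤ c := by
    have := (norm_nonneg _).trans (h 0 0)
    exact nonneg_of_mul_nonneg_left this (bracket_pos _ _)
  set W := ∫⁻ ξ : ℝ, ENNReal.ofReal (bracket (-1) ξ) ^ 2
  have hb : Measurable fun ξ => ENNReal.ofReal (bracket (-1) ξ) :=
    (measurable_bracket _).ennreal_ofReal
  have key : ∀ ξ, (∫⁻ ζ, ‖k ξ ζ‖ₑ * (f ζ * g (ξ - ζ))) ^ 2 ≤
      ENNReal.ofReal c ^ 2 * ((∫⁻ ζ, f ζ ^ 2) * ∫⁻ ζ, g ζ ^ 2) *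
        ENNReal.ofReal (bracket (-1) ξ) ^ 2 := by
    intro ξ
    have hg' : Measurable fun ζ => g (ξ - ζ) := hg.comp (measurable_const.sub measurable_id)
    calc (∫⁻ ζ, ‖k ξ ζ‖ₑ * (f ζ * g (ξ - ζ))) ^ 2
        ≤ (∫⁻ ζ, (ENNReal.ofReal c * ENNReal.ofReal (bracket (-1) ξ)) * (f ζ * g (ξ - ζ))) ^ 2 := by
          gcongr with ζ
          rw [← ENNReal.ofReal_mul hc, ← ofReal_norm]
          exact ENNReal.ofReal_le_ofReal (h ξ ζ)
      _ = (ENNReal.ofReal c * ENNReal.ofReal (bracket (-1) ξ)) ^ 2 *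
          (∫⁻ ζ, f ζ * g (ξ - ζ)) ^ 2 := by
          have hm : Measurable fun ζ => f ζ * g (ξ - ζ) := hf.mul hg'
          rw [lintegral_const_mul _ hm, mul_pow]
      _ ≤ (ENNReal.ofReal c * ENNReal.ofReal (bracket (-1) ξ)) ^ 2 *
          ((∫⁻ ζ, f ζ ^ 2) * ∫⁻ ζ, g (ξ - ζ) ^ 2) := by
          gcongr
          exact sq_lintegral_mul_le hf.aemeasurable hg'.aemeasurable
      _ = _ := by
          rw [lintegral_sub_left_eq_self (fun x => g x ^ 2) ξ]
          ring
  refine (lintegral_mono key).trans (le_of_eq ?_)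
  rw [lintegral_const_mul _ (hb.pow_const 2)]
  ring

/-! ### The bounded operator on `L²` attached to a kernel -/

namespace IsBilinKernel

variable {k : ℝ → ℝ → ℂ}

theorem stronglyMeasurable_integrand (hk : IsBilinKernel k) {f g : ℝ → ℂ}
    (hf : StronglyMeasurable f) (hg : StronglyMeasurable g) :
    StronglyMeasurable fun p : ℝ × ℝ => k p.1 p.2 * (f p.2 * g (p.1 - p.2)) :=
  hk.measurable.stronglyMeasurable.mul ((hf.comp_measurable measurable_snd).mul
    (hg.comp_measurable (measurable_fst.sub measurable_snd)))

theorem lintegral_sq_enorm (f : L2) : ∫⁻ x, ‖f x‖ₑ ^ 2 = ‖f‖ₑ ^ 2 := by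
  rw [Lp.enorm_def, eLpNorm_eq_lintegral_rpow_enorm_toReal (by norm_num) (by norm_num)]
  rw [← ENNReal.rpow_natCast, ← ENNReal.rpow_mul]
  simp

theorem exists_lintegral_le (hk : IsBilinKernel k) : ∃ A : ℝ, 0 ≤ A ∧ ∀ f g : L2,
    ∫⁻ ξ, (∫⁻ ζ, ‖k ξ ζ * (f ζ * g (ξ - ζ))‖ₑ) ^ 2 ≤
      ENNReal.ofReal A * (‖f‖ₑ ^ 2 * ‖g‖ₑ ^ 2) := by
  obtain ⟨A, hA, h⟩ := hk.bound
  refine ⟨A, hA, fun f g => ?_⟩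
  have := h (fun x => ‖f x‖ₑ) (fun x => ‖g x‖ₑ) (Lp.stronglyMeasurable f).measurable.enorm
    (Lp.stronglyMeasurable g).measurable.enorm
  rw [lintegral_sq_enorm, lintegral_sq_enorm] at this
  simpa only [enorm_mul] using this

/-- Additivity of the Bochner integral needs this. It holds because the square of the inner integral
of norms has a finite integral over ξ. -/
theorem ae_integrable (hk : IsBilinKernel k) (f g : L2) :
    ∀ᵐ ξ, Integrable fun ζ => k ξ ζ * (f ζ * g (ξ - ζ)) := by
  obtain ⟨A, -, h⟩ := hk.exists_lintegral_le
  have hs := hk.stronglyMeasurable_integrand (Lp.stronglyMeasurable f) (Lp.stronglyMeasurable g)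
  have h1 : ∀ᵐ ξ, (∫⁻ ζ, ‖k ξ ζ * (f ζ * g (ξ - ζ))‖ₑ) ^ 2 < ⊤ := by
    refine ae_lt_top (hs.enorm.lintegral_prod_right'.pow_const 2) (ne_top_of_le_ne_top ?_ (h f g))
    finiteness
  filter_upwards [h1] with ξ hξ
  refine ⟨(hs.comp_measurable measurable_prodMk_left).aestronglyMeasurable, ?_⟩
  rw [hasFiniteIntegral_iff_enorm]
  by_contra hc
  simp only [not_lt, top_le_iff] at hc
  rw [hc] at hξ
  simp at hξ

theorem memLp (hk : IsBilinKernel k) (f g : L2) :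
    MemLp (fun ξ => ∫ ζ, k ξ ζ * (f ζ * g (ξ - ζ))) 2 volume := by
  obtain ⟨A, -, h⟩ := hk.exists_lintegral_le
  have hs := hk.stronglyMeasurable_integrand (Lp.stronglyMeasurable f) (Lp.stronglyMeasurable g)
  refine ⟨hs.integral_prod_right'.aestronglyMeasurable, ?_⟩
  rw [eLpNorm_lt_top_iff_lintegral_rpow_enorm_lt_top (by norm_num) (by norm_num)]
  refine lt_of_le_of_lt (lintegral_mono fun ξ => ?_)
    (lt_of_le_of_lt (h f g) (by finiteness))
  simp only [ENNReal.toReal_ofNat, ENNReal.rpow_ofNat]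
  gcongr
  exact enorm_integral_le_lintegral_enorm _

theorem exists_norm_toLp_le (hk : IsBilinKernel k) : ∃ A : ℝ, ∀ f g : L2,
    ‖(hk.memLp f g).toLp‖ ≤ A * ‖f‖ * ‖g‖ := by
  obtain ⟨A, hA, h⟩ := hk.exists_lintegral_le
  refine ⟨√A, fun f g => ?_⟩
  have h1 : ‖(hk.memLp f g).toLp‖ₑ ^ 2 ≤ ENNReal.ofReal A * (‖f‖ₑ ^ 2 * ‖g‖ₑ ^ 2) := by
    rw [← lintegral_sq_enorm]
    refine le_trans (lintegral_mono_ae ?_) (h f g)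
    filter_upwards [(hk.memLp f g).coeFn_toLp] with ξ hξ
    rw [hξ]
    gcongr
    exact enorm_integral_le_lintegral_enorm _
  simp only [← ofReal_norm] at h1
  rw [← ENNReal.ofReal_pow (norm_nonneg _), ← ENNReal.ofReal_pow (norm_nonneg _),
    ← ENNReal.ofReal_pow (norm_nonneg _), ← ENNReal.ofReal_mul (by positivity),
    ← ENNReal.ofReal_mul hA, ENNReal.ofReal_le_ofReal_iff (by positivity)] at h1
  refine abs_le_of_sq_le_sq' ?_ (by positivity) |>.2
  rw [mul_pow, mul_pow, Real.sq_sqrt hA]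
  linarith

theorem ae_sub_left {p : ℝ → Prop} (h : ∀ᵐ x, p x) (ξ : ℝ) : ∀ᵐ ζ, p (ξ - ζ) :=
  (quasiMeasurePreserving_sub_left_of_right_invariant volume ξ).ae h

theorem toLp_add_left (hk : IsBilinKernel k) (f f' g : L2) :
    (hk.memLp (f + f') g).toLp = (hk.memLp f g).toLp + (hk.memLp f' g).toLp := by
  rw [← MemLp.toLp_add]
  refine MemLp.toLp_congr _ _ ?_
  filter_upwards [hk.ae_integrable f g, hk.ae_integrable f' g] with ξ h1 h2
  simp only [Pi.add_apply]
  rw [← integral_add h1 h2]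
  refine integral_congr_ae ?_
  filter_upwards [Lp.coeFn_add f f'] with ζ hζ
  rw [hζ, Pi.add_apply]
  ring

theorem toLp_add_right (hk : IsBilinKernel k) (f g g' : L2) :
    (hk.memLp f (g + g')).toLp = (hk.memLp f g).toLp + (hk.memLp f g').toLp := by
  rw [← MemLp.toLp_add]
  refine MemLp.toLp_congr _ _ ?_
  filter_upwards [hk.ae_integrable f g, hk.ae_integrable f g'] with ξ h1 h2
  simp only [Pi.add_apply]
  rw [← integral_add h1 h2]
  refine integral_congr_ae ?_
  filter_upwards [ae_sub_left (Lp.coeFn_add g g') ξ] with ζ hζ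
  rw [hζ, Pi.add_apply]
  ring

theorem toLp_smul_left (hk : IsBilinKernel k) (c : ℂ) (f g : L2) :
    (hk.memLp (c • f) g).toLp = c • (hk.memLp f g).toLp := by
  rw [← MemLp.toLp_const_smul]
  refine MemLp.toLp_congr _ _ (Filter.Eventually.of_forall fun ξ => ?_)
  simp only [Pi.smul_apply, smul_eq_mul]
  rw [← integral_const_mul]
  refine integral_congr_ae ?_
  filter_upwards [Lp.coeFn_smul c f] with ζ hζ
  rw [hζ, Pi.smul_apply, smul_eq_mul]
  ring

theorem toLp_smul_right (hk : IsBilinKernel k) (c : ℂ) (f g : L2) :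
    (hk.memLp f (c • g)).toLp = c • (hk.memLp f g).toLp := by
  rw [← MemLp.toLp_const_smul]
  refine MemLp.toLp_congr _ _ (Filter.Eventually.of_forall fun ξ => ?_)
  simp only [Pi.smul_apply, smul_eq_mul]
  rw [← integral_const_mul]
  refine integral_congr_ae ?_
  filter_upwards [ae_sub_left (Lp.coeFn_smul c g) ξ] with ζ hζ
  rw [hζ, Pi.smul_apply, smul_eq_mul]
  ring

/-- The bounded bilinear operator `(f, g) ↦ ∫ k(·, ζ) f(ζ) g(· - ζ) dζ` on `L²`. -/
def bilin (hk : IsBilinKernel k) : L2 →L[ℂ] L2 →L[ℂ] L2 :=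
  LinearMap.mkContinuous₂
    (LinearMap.mk₂ ℂ (fun f g => (hk.memLp f g).toLp) hk.toLp_add_left hk.toLp_smul_left
      hk.toLp_add_right hk.toLp_smul_right)
    hk.exists_norm_toLp_le.choose hk.exists_norm_toLp_le.choose_spec

theorem coeFn_bilin (hk : IsBilinKernel k) (f g : L2) :
    hk.bilin f g =ᵐ[volume] fun ξ => ∫ ζ, k ξ ζ * (f ζ * g (ξ - ζ)) :=
  (hk.memLp f g).coeFn_toLp

end IsBilinKernel

end FifthOrderBBM

end

noncomputable section

namespace FifthOrderBBM

/-! ### Multiplication operators on `L²` and the linear propagator -/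

/-- The bilinear pairing `∫ f g` on `L²`. -/
def pair : L2 →L[ℂ] L2 →L[ℂ] ℂ := (ContinuousLinearMap.mul ℂ ℂ).lpPairing volume 2 2

theorem pair_apply (f g : L2) : pair f g = ∫ x, f x * g x :=
  ContinuousLinearMap.lpPairing_eq_integral _ f g

open Classical in
/-- The operator of multiplication by an essentially bounded function. -/
def mulOp (m : ℝ → ℂ) : L2 →L[ℂ] L2 :=
  if h : MemLp m ∞ volume then (ContinuousLinearMap.mul ℂ ℂ).holderL volume ∞ 2 2 h.toLp else 0

theorem coeFn_mulOp {m : ℝ → ℂ} (h : MemLp m ∞ volume) (f : L2) :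
    mulOp m f =ᵐ[volume] fun x => m x * f x := by
  rw [mulOp, dif_pos h]
  refine (ContinuousLinearMap.coeFn_holder (r := 2) (ContinuousLinearMap.mul ℂ ℂ) h.toLp f).trans ?_
  filter_upwards [h.coeFn_toLp] with x hx
  simp [hx]

theorem pair_mulOp_left {m : ℝ → ℂ} (hm : MemLp m ∞ volume) (f g : L2) :
    pair (mulOp m f) g = pair f (mulOp m g) := by
  rw [pair_apply, pair_apply]
  refine integral_congr_ae ?_
  filter_upwards [coeFn_mulOp hm f, coeFn_mulOp hm g] with x h1 h2
  rw [h1, h2]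
  ring

/-- Dominated convergence in `L²` for families given by explicit representatives. Choosing `G` by
formula matters: the pointwise limit is taken in `i`, while each `F i` is only a class modulo null
sets. -/
theorem tendsto_zero_of_dominated {ι : Type*} {l : Filter ι} [l.IsCountablyGenerated]
    {F : ι → L2} {G : ι → ℝ → ℂ} (hG : ∀ i, Measurable (G i)) (hFG : ∀ i, F i =ᵐ[volume] G i)
    (h : L2) (C : ℝ)
    (hb : ∀ᶠ i in l, ∀ᵐ x, ‖G i x‖ ≤ C * ‖h x‖)
    (hl : ∀ᵐ x, Filter.Tendsto (fun i => G i x) l (𝓝 0)) : Filter.Tendsto F l (𝓝 0) := by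
  have h1 : Filter.Tendsto (fun i => ∫⁻ x, ‖G i x‖ₑ ^ 2) l (𝓝 (∫⁻ _ : ℝ, 0)) := by
    refine tendsto_lintegral_filter_of_dominated_convergence
      (fun x => ENNReal.ofReal C ^ 2 * ‖h x‖ₑ ^ 2) ?_ ?_ ?_ ?_
    · refine Filter.Eventually.of_forall fun i => ?_
      exact (hG i).enorm.pow_const 2
    · filter_upwards [hb] with i hi
      filter_upwards [hi] with x hx
      rw [← mul_pow]
      gcongr
      by_cases hC : 0 ≤ C
      · rw [← ofReal_norm, ← ofReal_norm, ← ENNReal.ofReal_mul hC]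
        exact ENNReal.ofReal_le_ofReal hx
      · have : ‖G i x‖ ≤ 0 :=
          hx.trans (mul_nonpos_of_nonpos_of_nonneg (by linarith) (norm_nonneg _))
        have : G i x = 0 := norm_le_zero_iff.1 this
        simp [this]
    · rw [lintegral_const_mul _ ((Lp.stronglyMeasurable h).measurable.enorm.pow_const 2),
        IsBilinKernel.lintegral_sq_enorm]
      finiteness
    · filter_upwards [hl] with x hx
      have : Filter.Tendsto (fun i => ‖G i x‖ₑ ^ 2) l (𝓝 (‖(0 : ℂ)‖ₑ ^ 2)) :=
        (ENNReal.continuous_pow 2).tendsto _ |>.comp (hx.enorm)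
      simpa using this
  have h2 : Filter.Tendsto (fun i => ‖F i‖ₑ ^ 2) l (𝓝 0) := by
    simp only [lintegral_const, zero_mul] at h1
    refine h1.congr fun i => ?_
    rw [← IsBilinKernel.lintegral_sq_enorm]
    refine lintegral_congr_ae ?_
    filter_upwards [hFG i] with x hx
    rw [hx]
  have h3 := (ENNReal.continuous_rpow_const (y := (1 / 2 : ℝ))).tendsto _ |>.comp h2
  have h4 : Filter.Tendsto (fun i => ‖F i‖ₑ) l (𝓝 0) := by
    have e : ∀ i, (‖F i‖ₑ ^ 2) ^ (1 / 2 : ℝ) = ‖F i‖ₑ := fun i => by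
      rw [← ENNReal.rpow_natCast, ← ENNReal.rpow_mul]
      simp
    simpa only [Function.comp_def, e,
      ENNReal.zero_rpow_of_pos (by norm_num : (0 : ℝ) < 1 / 2)] using h3
  rw [tendsto_zero_iff_norm_tendsto_zero]
  have h5 := (ENNReal.tendsto_toReal (a := 0) (by simp)).comp h4
  simpa [Function.comp_def] using h5

/-- The unitary operator of multiplication by `e^{i t φ(ξ)}`. -/
def propagator (φ : ℝ → ℝ) (t : ℝ) : L2 →L[ℂ] L2 :=
  mulOp fun ξ => Complex.exp (((t * φ ξ : ℝ) : ℂ) * Complex.I)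

variable {φ : ℝ → ℝ}

theorem memLp_exp (hφ : Measurable φ) (t : ℝ) :
    MemLp (fun ξ => Complex.exp (((t * φ ξ : ℝ) : ℂ) * Complex.I)) ∞ volume := by
  refine memLp_top_of_bound (by fun_prop) 1 (Filter.Eventually.of_forall fun ξ => ?_)
  rw [Complex.norm_exp_ofReal_mul_I]

theorem coeFn_propagator (hφ : Measurable φ) (t : ℝ) (f : L2) :
    propagator φ t f =ᵐ[volume] fun ξ => Complex.exp (((t * φ ξ : ℝ) : ℂ) * Complex.I) * f ξ :=
  coeFn_mulOp (memLp_exp hφ t) f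

theorem norm_propagator (hφ : Measurable φ) (t : ℝ) (f : L2) : ‖propagator φ t f‖ = ‖f‖ := by
  apply le_antisymm
  · apply Lp.norm_le_norm_of_ae_le
    filter_upwards [coeFn_propagator hφ t f] with x hx
    rw [hx, norm_mul, Complex.norm_exp_ofReal_mul_I, one_mul]
  · apply Lp.norm_le_norm_of_ae_le
    filter_upwards [coeFn_propagator hφ t f] with x hx
    rw [hx, norm_mul, Complex.norm_exp_ofReal_mul_I, one_mul]

theorem propagator_propagator (hφ : Measurable φ) (t u : ℝ) (f : L2) :
    propagator φ t (propagator φ u f) = propagator φ (t + u) f := by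
  apply Lp.ext
  filter_upwards [coeFn_propagator hφ t (propagator φ u f), coeFn_propagator hφ u f,
    coeFn_propagator hφ (t + u) f] with x h1 h2 h3
  rw [h1, h2, h3, ← mul_assoc, ← Complex.exp_add]
  congr 2
  push_cast
  ring

@[simp] theorem propagator_zero (hφ : Measurable φ) (f : L2) : propagator φ 0 f = f := by
  apply Lp.ext
  filter_upwards [coeFn_propagator hφ 0 f] with x h1
  simp [h1]

theorem pair_propagator (hφ : Measurable φ) (t : ℝ) (f g : L2) :
    pair (propagator φ t f) g = pair f (propagator φ t g) :=
  pair_mulOp_left (memLp_exp hφ t) f g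

/-- Only strong continuity can be expected, as the phase may be unbounded. It follows from dominated
convergence. -/
theorem continuous_propagator (hφ : Measurable φ) (f : L2) :
    Continuous fun t => propagator φ t f := by
  rw [continuous_iff_continuousAt]
  intro t
  rw [ContinuousAt, ← tendsto_sub_nhds_zero_iff]
  refine tendsto_zero_of_dominated
    (G := fun u ξ => (Complex.exp (((u * φ ξ : ℝ) : ℂ) * Complex.I) -
      Complex.exp (((t * φ ξ : ℝ) : ℂ) * Complex.I)) * f ξ)
    (fun u => by have := (Lp.stronglyMeasurable f).measurable; fun_prop) (fun u => ?_) f 2 ?_ ?_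
  · filter_upwards [coeFn_propagator hφ u f, coeFn_propagator hφ t f,
      Lp.coeFn_sub (propagator φ u f) (propagator φ t f)] with x h1 h2 h3
    rw [h3, Pi.sub_apply, h1, h2]
    ring
  · refine Filter.Eventually.of_forall fun u => Filter.Eventually.of_forall fun ξ => ?_
    rw [norm_mul]
    gcongr
    refine (norm_sub_le _ _).trans ?_
    rw [Complex.norm_exp_ofReal_mul_I, Complex.norm_exp_ofReal_mul_I]
    norm_num
  · refine Filter.Eventually.of_forall fun ξ => ?_
    have : Continuous fun u : ℝ => (Complex.exp (((u * φ ξ : ℝ) : ℂ) * Complex.I) -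
      Complex.exp (((t * φ ξ : ℝ) : ℂ) * Complex.I)) * f ξ := by fun_prop
    simpa using this.tendsto t

/-- Strong continuity becomes joint continuity because every propagator is an isometry. -/
theorem continuous_propagator_apply {X : Type*} [TopologicalSpace X] (hφ : Measurable φ)
    {a : X → ℝ} {f : X → L2} (ha : Continuous a) (hf : Continuous f) :
    Continuous fun x => propagator φ (a x) (f x) := by
  rw [continuous_iff_continuousAt]
  intro x
  rw [ContinuousAt, tendsto_iff_norm_sub_tendsto_zero]
  have h1 : Filter.Tendsto (fun y => ‖f y - f x‖ + ‖propagator φ (a y) (f x) -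
      propagator φ (a x) (f x)‖) (𝓝 x) (𝓝 0) := by
    have : Continuous fun y => ‖f y - f x‖ + ‖propagator φ (a y) (f x) -
      propagator φ (a x) (f x)‖ :=
      (hf.sub continuous_const).norm.add
        ((((continuous_propagator hφ (f x)).comp ha).sub continuous_const).norm)
    simpa using this.tendsto x
  refine squeeze_zero (fun _ => norm_nonneg _) (fun y => ?_) h1
  calc ‖propagator φ (a y) (f y) - propagator φ (a x) (f x)‖
      = ‖propagator φ (a y) (f y - f x) + (propagator φ (a y) (f x) -
          propagator φ (a x) (f x))‖ := by rw [map_sub]; congr 1; abel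
    _ ≤ _ := (norm_add_le _ _).trans (by rw [norm_propagator hφ])

theorem hasDerivAt_exp_mul_I (a t : ℝ) :
    HasDerivAt (fun u : ℝ => Complex.exp (((u * a : ℝ) : ℂ) * Complex.I))
      (Complex.exp (((t * a : ℝ) : ℂ) * Complex.I) * (a * Complex.I)) t := by
  have h : HasDerivAt (fun u : ℝ => ((u * a : ℝ) : ℂ) * Complex.I) ((a : ℂ) * Complex.I) t := by
    have := ((hasDerivAt_id t).mul_const a).ofReal_comp.mul_const Complex.I
    simpa using this
  exact h.cexp

theorem norm_exp_sub_exp_le (a b : ℝ) :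
    ‖Complex.exp ((a : ℂ) * Complex.I) - Complex.exp ((b : ℂ) * Complex.I)‖ ≤ |a - b| := by
  have e : Complex.exp ((a : ℂ) * Complex.I) - Complex.exp ((b : ℂ) * Complex.I) =
      Complex.exp ((b : ℂ) * Complex.I) * (Complex.exp (Complex.I * ((a - b : ℝ) : ℂ)) - 1) := by
    rw [mul_sub, ← Complex.exp_add, mul_one]
    congr 2
    push_cast
    ring
  rw [e, norm_mul, Complex.norm_exp_ofReal_mul_I, one_mul]
  exact Real.norm_exp_I_mul_ofReal_sub_one_le

/-- The vector `h` lies in the domain of the generator, since φ·h is again in `L²`. The difference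
quotients of the exponential and its derivative are each at most |φ|, so 2|φh| dominates. -/
theorem hasDerivAt_propagator (hφ : Measurable φ) {h h' : L2}
    (hh : h' =ᵐ[volume] fun ξ => (φ ξ : ℂ) * h ξ) (t : ℝ) :
    HasDerivAt (fun t => propagator φ t h) (propagator φ t (Complex.I • h')) t := by
  rw [hasDerivAt_iff_tendsto_slope_zero, ← tendsto_sub_nhds_zero_iff]
  refine tendsto_zero_of_dominated
    (G := fun u ξ => (u⁻¹ • (Complex.exp ((((t + u) * φ ξ : ℝ) : ℂ) * Complex.I) -
      Complex.exp (((t * φ ξ : ℝ) : ℂ) * Complex.I)) -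
      Complex.exp (((t * φ ξ : ℝ) : ℂ) * Complex.I) * (φ ξ * Complex.I)) * h ξ)
      (fun u => by
        have := (Lp.stronglyMeasurable h).measurable
        exact ((((by fun_prop : Measurable _).sub (by fun_prop : Measurable _)).const_smul u⁻¹).sub
          (by fun_prop)).mul this)
      (fun u => ?_) h' 2 ?_ ?_
  · filter_upwards [coeFn_propagator hφ (t + u) h, coeFn_propagator hφ t h,
      coeFn_propagator hφ t (Complex.I • h'), Lp.coeFn_smul Complex.I h', hh,
      Lp.coeFn_sub (propagator φ (t + u) h) (propagator φ t h),
      Lp.coeFn_smul u⁻¹ (propagator φ (t + u) h - propagator φ t h),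
      Lp.coeFn_sub (u⁻¹ • (propagator φ (t + u) h - propagator φ t h))
        (propagator φ t (Complex.I • h'))] with x h1 h2 h3 h4 h5 h6 h7 h8
    rw [h8, Pi.sub_apply, h7, Pi.smul_apply, h6, Pi.sub_apply, h1, h2, h3, h4, Pi.smul_apply, h5]
    simp only [Complex.real_smul, smul_eq_mul]
    ring
  · refine Filter.Eventually.of_forall fun u => ?_
    filter_upwards [hh] with ξ hξ
    rw [norm_mul, hξ, norm_mul (φ ξ : ℂ), ← mul_assoc (2 : ℝ)]
    gcongr
    refine (norm_sub_le _ _).trans ?_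
    have h1 : ‖u⁻¹ • (Complex.exp ((((t + u) * φ ξ : ℝ) : ℂ) * Complex.I) -
      Complex.exp (((t * φ ξ : ℝ) : ℂ) * Complex.I))‖ ≤ |φ ξ| := by
      rw [norm_smul, norm_inv, Real.norm_eq_abs]
      rcases eq_or_ne u 0 with rfl | hu
      · simp
      rw [inv_mul_le_iff₀ (abs_pos.2 hu)]
      refine (norm_exp_sub_exp_le _ _).trans (le_of_eq ?_)
      rw [← abs_mul]
      congr 1
      ring
    have h2 : ‖Complex.exp (((t * φ ξ : ℝ) : ℂ) * Complex.I) * (φ ξ * Complex.I)‖ = |φ ξ| := by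
      rw [norm_mul, Complex.norm_exp_ofReal_mul_I]
      simp
    rw [h2, Complex.norm_real, Real.norm_eq_abs]
    linarith
  · refine Filter.Eventually.of_forall fun ξ => ?_
    have h1 := hasDerivAt_iff_tendsto_slope_zero.1 (hasDerivAt_exp_mul_I (φ ξ) t)
    have h2 := (tendsto_sub_nhds_zero_iff.2 h1).mul_const (h ξ)
    simpa using h2

end FifthOrderBBM

end

noncomputable section

namespace FifthOrderBBM

open FourierTransform

/-! ### Products and the Fourier transform -/

/-- The convolution of two `L²` functions need not be in `L²`, but it is after multiplication by
this weight. The convolution theorem below is therefore phrased with the weight, compensated on the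
test function. -/
theorem isBilinKernel_bracket : IsBilinKernel fun ξ _ => ((bracket (-1) ξ : ℝ) : ℂ) := by
  refine isBilinKernel_of_le_right (c := 1) ?_ fun ξ ζ => ?_
  · exact (Complex.measurable_ofReal.comp (measurable_bracket (-1))).comp measurable_fst
  · rw [Complex.norm_real, Real.norm_of_nonneg (bracket_pos _ _).le, one_mul]

/-- A Schwartz function as an element of `L²`. -/
abbrev schwartzL2 (ψ : 𝓢(ℝ, ℂ)) : L2 := ψ.toLp 2

theorem coeFn_schwartzL2 (ψ : 𝓢(ℝ, ℂ)) : schwartzL2 ψ =ᵐ[volume] ψ := ψ.coeFn_toLp 2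

theorem denseRange_schwartzL2 : DenseRange schwartzL2 :=
  SchwartzMap.denseRange_toLpCLM (p := 2) (F := ℂ) (μ := (volume : Measure ℝ)) ENNReal.ofNat_ne_top

theorem memLp_top_schwartz (ψ : 𝓢(ℝ, ℂ)) : MemLp ψ ∞ (volume : Measure ℝ) := ψ.memLp ∞

theorem fourierInv_mul_fourierInv (f g : 𝓢(ℝ, ℂ)) (x : ℝ) :
    (𝓕⁻ f) x * (𝓕⁻ g) x = (𝓕⁻ (SchwartzMap.convolution (ContinuousLinearMap.mul ℂ ℂ) f g)) x := by
  rw [SchwartzMap.fourierInv_apply_eq, SchwartzMap.fourierInv_apply_eq,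
    SchwartzMap.fourierInv_apply_eq]
  simp [SchwartzMap.fourier_convolution]

/-- The convolution theorem for `L²` functions, tested against 𝓕Ψ. Both sides are continuous in (F,
G), so the Schwartz case implies the general one. -/
theorem pair_fourierInv_mul (F G : L2) (Ψ : 𝓢(ℝ, ℂ)) :
    pair (𝓕⁻ F) (mulOp (𝓕 Ψ : 𝓢(ℝ, ℂ)) (𝓕⁻ G)) =
      pair (schwartzL2 (SchwartzMap.smulLeftCLM ℂ (fun ξ : ℝ => ((bracket 1 ξ : ℝ) : ℂ)) Ψ))
        (isBilinKernel_bracket.bilin F G) := by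
  refine denseRange_schwartzL2.induction_on₂
    (p := fun F G => pair (𝓕⁻ F) (mulOp (𝓕 Ψ : 𝓢(ℝ, ℂ)) (𝓕⁻ G)) =
      pair (schwartzL2 (SchwartzMap.smulLeftCLM ℂ (fun ξ : ℝ => ((bracket 1 ξ : ℝ) : ℂ)) Ψ))
        (isBilinKernel_bracket.bilin F G)) ?_ ?_ F G
  · have hF : Continuous fun F : L2 => (𝓕⁻ F : L2) := continuous_fourierInv
    have h1 : Continuous fun x : L2 × L2 => pair (𝓕⁻ x.1) :=
      pair.continuous.comp (hF.comp continuous_fst)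
    have h2 : Continuous fun x : L2 × L2 => mulOp (𝓕 Ψ : 𝓢(ℝ, ℂ)) (𝓕⁻ x.2) :=
      (mulOp _).continuous.comp (hF.comp continuous_snd)
    have h3 : Continuous fun x : L2 × L2 => isBilinKernel_bracket.bilin x.1 :=
      isBilinKernel_bracket.bilin.continuous.comp continuous_fst
    exact isClosed_eq (h1.clm_apply h2)
      ((ContinuousLinearMap.continuous _).comp (h3.clm_apply continuous_snd))
  · intro f g
    rw [SchwartzMap.toLp_fourierInv_eq, SchwartzMap.toLp_fourierInv_eq, pair_apply, pair_apply]
    set H := SchwartzMap.convolution (ContinuousLinearMap.mul ℂ ℂ) f g with hH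
    calc ∫ x, (schwartzL2 (𝓕⁻ f)) x * (mulOp (𝓕 Ψ : 𝓢(ℝ, ℂ)) (schwartzL2 (𝓕⁻ g))) x
        = ∫ x, (𝓕 Ψ) x * (𝓕⁻ H) x := by
          refine integral_congr_ae ?_
          filter_upwards [coeFn_schwartzL2 (𝓕⁻ f), coeFn_schwartzL2 (𝓕⁻ g),
            coeFn_mulOp (memLp_top_schwartz (𝓕 Ψ)) (schwartzL2 (𝓕⁻ g))] with x h1 h2 h3
          rw [h1, h3, h2, ← fourierInv_mul_fourierInv]
          ring
      _ = ∫ x, Ψ x * H x := by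
          rw [SchwartzMap.integral_fourier_mul_eq, fourier_fourierInv_eq]
      _ = _ := by
          refine integral_congr_ae ?_
          filter_upwards [coeFn_schwartzL2
            (SchwartzMap.smulLeftCLM ℂ (fun ξ : ℝ => ((bracket 1 ξ : ℝ) : ℂ)) Ψ),
            isBilinKernel_bracket.coeFn_bilin (schwartzL2 f) (schwartzL2 g)] with ξ h1 h2
          rw [h1, h2, SchwartzMap.smulLeftCLM_apply_apply (hasTemperateGrowth_bracket 1),
            integral_const_mul, hH, SchwartzMap.convolution_apply, convolution_def]
          have e : ∫ ζ, (schwartzL2 f) ζ * (schwartzL2 g) (ξ - ζ) = ∫ ζ, f ζ * g (ξ - ζ) := by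
            refine integral_congr_ae ?_
            filter_upwards [coeFn_schwartzL2 f,
              IsBilinKernel.ae_sub_left (coeFn_schwartzL2 g) ξ] with ζ h3 h4
            rw [h3, h4]
          rw [e]
          have e2 : ((bracket 1 ξ : ℝ) : ℂ) * ((bracket (-1) ξ : ℝ) : ℂ) = 1 := by
            rw [← Complex.ofReal_mul, bracket_mul]
            simp
          simp only [ContinuousLinearMap.mul_apply', smul_eq_mul]
          linear_combination (-Ψ ξ * ∫ ζ, f ζ * g (ξ - ζ)) * e2

/-- The outer symbol `m` may grow, so it cannot be applied to the product directly. The test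
function `h` absorbs it: only h·m = Ψ has to be Schwartz. -/
theorem pair_fourierInv_mulOp {m p q : ℝ → ℂ}
    (hk : IsBilinKernel fun ξ ζ => m ξ * (p ζ * q (ξ - ζ))) (hp : MemLp p ∞ volume)
    (hq : MemLp q ∞ volume) (f g h : L2) (Ψ : 𝓢(ℝ, ℂ))
    (hh : ∀ᵐ ξ, h ξ * m ξ = Ψ ξ) :
    ∫ x, (𝓕 Ψ) x * ((𝓕⁻ (mulOp p f) : L2) x * (𝓕⁻ (mulOp q g) : L2) x) =
      pair h (hk.bilin f g) := by
  have h1 := pair_fourierInv_mul (mulOp p f) (mulOp q g) Ψ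
  rw [pair_apply, pair_apply] at h1
  rw [pair_apply]
  convert! h1 using 1
  · refine integral_congr_ae ?_
    filter_upwards [coeFn_mulOp (memLp_top_schwartz (𝓕 Ψ)) (𝓕⁻ (mulOp q g))] with x h3
    rw [h3]
    ring
  · refine integral_congr_ae ?_
    filter_upwards [coeFn_schwartzL2
      (SchwartzMap.smulLeftCLM ℂ (fun ξ : ℝ => ((bracket 1 ξ : ℝ) : ℂ)) Ψ),
      isBilinKernel_bracket.coeFn_bilin (mulOp p f) (mulOp q g), hk.coeFn_bilin f g, hh]
      with ξ h1 h2 h3 h4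
    rw [h1, h2, h3, SchwartzMap.smulLeftCLM_apply_apply (hasTemperateGrowth_bracket 1),
      integral_const_mul]
    have e : ∫ ζ, (mulOp p f) ζ * (mulOp q g) (ξ - ζ) =
        ∫ ζ, (p ζ * q (ξ - ζ)) * (f ζ * g (ξ - ζ)) := by
      refine integral_congr_ae ?_
      filter_upwards [coeFn_mulOp hp f,
        IsBilinKernel.ae_sub_left (coeFn_mulOp hq g) ξ] with ζ h3 h4
      rw [h3, h4]
      ring
    rw [e]
    simp_rw [mul_assoc (m ξ)]
    rw [integral_const_mul]
    have e2 : ((bracket 1 ξ : ℝ) : ℂ) * ((bracket (-1) ξ : ℝ) : ℂ) = 1 := by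
      rw [← Complex.ofReal_mul, bracket_mul]
      simp
    simp only [smul_eq_mul]
    linear_combination (∫ ζ, (p ζ * q (ξ - ζ)) * (f ζ * g (ξ - ζ))) * h4 -
      (Ψ ξ * ∫ ζ, (p ζ * q (ξ - ζ)) * (f ζ * g (ξ - ζ))) * e2

/-! ### Sobolev functions on the Fourier side -/

theorem toTemperedDistribution_mulOp {m : ℝ → ℂ} (hm : m.HasTemperateGrowth)
    (hb : MemLp m ∞ volume) (f : L2) :
    ((mulOp m f : L2) : 𝓢'(ℝ, ℂ)) = TemperedDistribution.smulLeftCLM ℂ m (f : 𝓢'(ℝ, ℂ)) := by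
  ext φ
  simp only [Lp.toTemperedDistribution_apply, TemperedDistribution.smulLeftCLM_apply_apply]
  refine integral_congr_ae ?_
  filter_upwards [coeFn_mulOp hb f] with x hx
  rw [hx, SchwartzMap.smulLeftCLM_apply_apply hm]
  simp only [smul_eq_mul]
  ring

theorem memLp_bracket {a : ℝ} (ha : a ≤ 0) :
    MemLp (fun ξ : ℝ => ((bracket a ξ : ℝ) : ℂ)) ∞ volume := by
  refine memLp_top_of_bound
    (Complex.measurable_ofReal.comp (measurable_bracket a)).aestronglyMeasurable 1
    (Filter.Eventually.of_forall fun ξ => ?_)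
  rw [Complex.norm_real, Real.norm_of_nonneg (bracket_pos _ _).le]
  exact bracket_le_one ha ξ

namespace Hs

variable {s : ℝ}

/-- The preimage is the Bessel potential of order -s. Surjectivity is what allows `L²` curves to be
carried back to `H^s`. -/
theorem toLp_surjective : Function.Surjective (toLp (s := s)) := by
  intro f
  have hf : TemperedDistribution.MemSobolev s 2
      (TemperedDistribution.besselPotential ℝ ℂ (-s) (f : 𝓢'(ℝ, ℂ))) :=
    ⟨f, by simp⟩
  refine ⟨⟨_, hf⟩, ?_⟩
  apply lp_toDist_injective
  refine (besselLp_spec _).symm.trans ?_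
  change TemperedDistribution.besselPotential ℝ ℂ s
    (TemperedDistribution.besselPotential ℝ ℂ (-s) (f : 𝓢'(ℝ, ℂ))) = _
  simp

/-- `H^s(ℝ)` is isometric to `L²(ℝ)` by `u ↦ (1 + |ξ|²)^{s/2} û`. -/
def hat (s : ℝ) : Hs s ≃ₗᵢ[ℂ] L2 :=
  (LinearIsometryEquiv.ofSurjective ⟨toLp, fun _ => rfl⟩ toLp_surjective).trans
    (Lp.fourierTransformₗᵢ ℝ ℂ)

theorem hat_apply (u : Hs s) : hat s u = 𝓕 (toLp u) := rfl

/-- The function represented by `u ∈ H^s(ℝ)`, `s ≥ 0`. -/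
theorem toDist_eq (hs : 0 ≤ s) (u : Hs s) :
    toDist u = ((𝓕⁻ (mulOp (fun ξ => ((bracket (-s) ξ : ℝ) : ℂ)) (hat s u)) : L2) : 𝓢'(ℝ, ℂ)) := by
  rw [← Lp.fourierInv_toTemperedDistribution_eq,
    toTemperedDistribution_mulOp (hasTemperateGrowth_bracket _) (memLp_bracket (by linarith)),
    hat_apply, ← Lp.fourier_toTemperedDistribution_eq]
  have h1 := besselLp_spec u
  have h2 := congrArg (TemperedDistribution.besselPotential ℝ ℂ (-s)) h1
  simp only [TemperedDistribution.besselPotential_besselPotential_apply, add_neg_cancel,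
    TemperedDistribution.besselPotential_zero, ContinuousLinearMap.id_apply] at h2
  rw [h2]
  rfl

end Hs

/-! ### Representatives and derivatives of tempered distributions -/

theorem l2Fun_coe (f : L2) : l2Fun (f : 𝓢'(ℝ, ℂ)) = f := by
  have h : ∃ g : L2, (f : 𝓢'(ℝ, ℂ)) = (g : 𝓢'(ℝ, ℂ)) := ⟨f, rfl⟩
  rw [l2Fun, dif_pos h]
  rw [← Hs.lp_toDist_injective h.choose_spec]

theorem ofL1_apply {f : ℝ → ℂ} (hf : Integrable f) (φ : 𝓢(ℝ, ℂ)) :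
    ofL1 f φ = ∫ x, φ x * f x := by
  have h : MemLp f 1 volume := memLp_one_iff_integrable.2 hf
  rw [ofL1, dif_pos h, Lp.toTemperedDistribution_apply]
  refine integral_congr_ae ?_
  filter_upwards [h.coeFn_toLp] with x hx
  rw [hx, smul_eq_mul]

/-- Multiplication of Schwartz functions by `2πiξ`. -/
def mulX : 𝓢(ℝ, ℂ) →L[ℂ] 𝓢(ℝ, ℂ) :=
  SchwartzMap.smulLeftCLM ℂ fun ξ : ℝ => (((2 * Real.pi * ξ : ℝ) : ℂ) * Complex.I)

theorem hasTemperateGrowth_symbolX :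
    (fun ξ : ℝ => (((2 * Real.pi * ξ : ℝ) : ℂ) * Complex.I)).HasTemperateGrowth := by
  simp only [Complex.ofReal_mul]
  fun_prop

theorem mulX_pow_apply (k : ℕ) (ψ : 𝓢(ℝ, ℂ)) (ξ : ℝ) :
    (mulX ^ k) ψ ξ = (((2 * Real.pi * ξ : ℝ) : ℂ) * Complex.I) ^ k * ψ ξ := by
  induction k generalizing ψ with
  | zero => simp
  | succ k ih =>
    rw [pow_succ, mul_apply_eq_comp, ih, mulX,
      SchwartzMap.smulLeftCLM_apply_apply hasTemperateGrowth_symbolX, smul_eq_mul, pow_succ]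
    ring

theorem neg_derivCLM_fourier (ψ : 𝓢(ℝ, ℂ)) :
    -SchwartzMap.derivCLM ℂ ℂ (𝓕 ψ) = 𝓕 (mulX ψ) := by
  ext x
  rw [neg_apply, SchwartzMap.derivCLM_apply, SchwartzMap.fourier_coe,
    SchwartzMap.fourier_coe]
  have h : deriv (𝓕 (ψ : ℝ → ℂ)) = 𝓕 (fun x : ℝ => (-2 * Real.pi * Complex.I * x) • ψ x) :=
    Real.deriv_fourier ψ.integrable (by
      have := (mulX ψ).integrable (μ := volume)
      refine this.const_mul ((2 * Real.pi * Complex.I)⁻¹) |>.congr ?_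
      refine Filter.Eventually.of_forall fun x => ?_
      have := mulX_pow_apply 1 ψ x
      simp only [pow_one] at this
      simp only [this, Complex.real_smul]
      push_cast
      field_simp)
  rw [h, Real.fourier_eq, Real.fourier_eq, ← integral_neg]
  refine integral_congr_ae (Filter.Eventually.of_forall fun v => ?_)
  have := mulX_pow_apply 1 ψ v
  simp only [pow_one] at this
  simp only [this, ← smul_neg, smul_eq_mul]
  congr 1
  push_cast
  ring

/-- No sign remains: the minus sign in the distributional derivative cancels the one in (𝓕ψ)' =
-𝓕(2πiξ ψ). -/
theorem dx_pow_apply_fourier (k : ℕ) (F : 𝓢'(ℝ, ℂ)) (ψ : 𝓢(ℝ, ℂ)) :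
    (dx ^ k) F (𝓕 ψ) = F (𝓕 ((mulX ^ k) ψ)) := by
  induction k generalizing F with
  | zero => simp
  | succ k ih =>
    rw [pow_succ, mul_apply_eq_comp, ih, TemperedDistribution.derivCLM_apply_apply,
      neg_derivCLM_fourier, pow_succ', mul_apply_eq_comp]

end FifthOrderBBM

end

noncomputable section

namespace FifthOrderBBM

open FourierTransform

/-! ### The symbols of the equation -/

/-- The symbol of `1 - γ₁ ∂ₓ² + δ₁ ∂ₓ⁴`. -/
def elliptic (γ₁ δ₁ ξ : ℝ) : ℝ := 1 + γ₁ * (2 * Real.pi * ξ) ^ 2 + δ₁ * (2 * Real.pi * ξ) ^ 4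

/-- The phase function: `∂ₜ η̂ = -i phase(ξ) η̂` is the linear part of the equation. -/
def phase (γ₁ γ₂ δ₁ δ₂ ξ : ℝ) : ℝ :=
  (2 * Real.pi * ξ - γ₂ * (2 * Real.pi * ξ) ^ 3 + δ₂ * (2 * Real.pi * ξ) ^ 5) / elliptic γ₁ δ₁ ξ

/-- The symbol of the Fourier variable `∂ₓ`. -/
def symX (ξ : ℝ) : ℂ := ((2 * Real.pi * ξ : ℝ) : ℂ) * Complex.I

/-- The symbol of `(c₁ ∂ₓ + c₂ ∂ₓ³) (1 - γ₁ ∂ₓ² + δ₁ ∂ₓ⁴)⁻¹`, with the weight of `H^s`. -/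
def outerSymbol (s γ₁ δ₁ : ℝ) (c₁ c₂ : ℂ) (ξ : ℝ) : ℂ :=
  (c₁ * symX ξ + c₂ * symX ξ ^ 3) * ((bracket s ξ / elliptic γ₁ δ₁ ξ : ℝ) : ℂ)

variable {s γ₁ δ₁ : ℝ}

theorem one_le_elliptic (hγ₁ : 0 < γ₁) (hδ₁ : 0 < δ₁) (ξ : ℝ) : 1 ≤ elliptic γ₁ δ₁ ξ := by
  have h1 : 0 ≤ γ₁ * (2 * Real.pi * ξ) ^ 2 := by positivity
  have h2 : 0 ≤ δ₁ * (2 * Real.pi * ξ) ^ 4 := by positivity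
  unfold elliptic
  linarith

theorem elliptic_pos (hγ₁ : 0 < γ₁) (hδ₁ : 0 < δ₁) (ξ : ℝ) : 0 < elliptic γ₁ δ₁ ξ :=
  zero_lt_one.trans_le (one_le_elliptic hγ₁ hδ₁ ξ)

/-- Ellipticity of order four, from δ₁ > 0: (1+ξ²)² ≤ 2 + 2ξ⁴, and both summands are controlled by 1
+ δ₁ξ⁴. The γ₁ term is nonnegative and is dropped. -/
theorem bracket_four_le (hγ₁ : 0 < γ₁) (hδ₁ : 0 < δ₁) (ξ : ℝ) :
    bracket 4 ξ ≤ (2 + 2 / δ₁) * elliptic γ₁ δ₁ ξ := by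
  have h4 : bracket 4 ξ = (1 + ξ ^ 2) ^ 2 := by
    rw [show (4 : ℝ) = 2 + 2 by norm_num, ← bracket_mul, bracket_two]
    ring
  have hπ : ξ ^ 4 ≤ (2 * Real.pi * ξ) ^ 4 := by
    rw [mul_pow]
    exact le_mul_of_one_le_left (by positivity)
      (one_le_pow₀ (by linarith [Real.pi_gt_three]))
  have h1 : 1 + δ₁ * ξ ^ 4 ≤ elliptic γ₁ δ₁ ξ := by
    have h1 : 0 ≤ γ₁ * (2 * Real.pi * ξ) ^ 2 := by positivity
    have h2 := mul_le_mul_of_nonneg_left hπ hδ₁.le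
    unfold elliptic
    linarith
  refine le_trans ?_ (mul_le_mul_of_nonneg_left h1 (by positivity))
  have e : (2 + 2 / δ₁) * (1 + δ₁ * ξ ^ 4) = 2 + 2 * ξ ^ 4 + (2 / δ₁ + 2 * δ₁ * ξ ^ 4) := by
    field_simp
    ring
  have : 0 ≤ 2 / δ₁ + 2 * δ₁ * ξ ^ 4 := by positivity
  rw [h4, e]
  nlinarith [sq_nonneg (ξ ^ 2 - 1)]

theorem bracket_div_elliptic_le (hγ₁ : 0 < γ₁) (hδ₁ : 0 < δ₁) (ξ : ℝ) :
    bracket s ξ / elliptic γ₁ δ₁ ξ ≤ (2 + 2 / δ₁) * bracket (s - 4) ξ := by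
  rw [div_le_iff₀ (elliptic_pos hγ₁ hδ₁ ξ)]
  calc bracket s ξ = bracket (s - 4) ξ * bracket 4 ξ := by rw [bracket_mul]; congr 1; ring
    _ ≤ bracket (s - 4) ξ * ((2 + 2 / δ₁) * elliptic γ₁ δ₁ ξ) :=
        mul_le_mul_of_nonneg_left (bracket_four_le hγ₁ hδ₁ ξ) (bracket_pos _ _).le
    _ = _ := by ring

theorem continuous_elliptic : Continuous (elliptic γ₁ δ₁) := by
  unfold elliptic
  fun_prop

/-- Smoothness is needed so that e^{itφ}ψ is again a test function when ψ has compact support. -/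
theorem contDiff_phase (hγ₁ : 0 < γ₁) (hδ₁ : 0 < δ₁) (γ₂ δ₂ : ℝ) :
    ContDiff ℝ ∞ (phase γ₁ γ₂ δ₁ δ₂) := by
  have h : ContDiff ℝ ∞ (elliptic γ₁ δ₁) := by unfold elliptic; fun_prop
  unfold phase
  exact ContDiff.div (by fun_prop) h fun ξ => (elliptic_pos hγ₁ hδ₁ ξ).ne'

theorem measurable_phase (γ₁ γ₂ δ₁ δ₂ : ℝ) : Measurable (phase γ₁ γ₂ δ₁ δ₂) := by
  have h : Measurable (elliptic γ₁ δ₁) := continuous_elliptic.measurable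
  unfold phase
  fun_prop

theorem measurable_symX : Measurable symX := by
  unfold symX
  fun_prop

theorem norm_symX_le (ξ : ℝ) : ‖symX ξ‖ ≤ 2 * Real.pi * bracket 1 ξ := by
  rw [symX, norm_mul, Complex.norm_I, mul_one, Complex.norm_real, Real.norm_eq_abs, abs_mul,
    abs_of_pos (by positivity : 0 < 2 * Real.pi)]
  gcongr
  exact abs_le_bracket_one ξ

theorem norm_outerSymbol_le_one (hγ₁ : 0 < γ₁) (hδ₁ : 0 < δ₁) (c : ℂ) (ξ : ℝ) :
    ‖outerSymbol s γ₁ δ₁ c 0 ξ‖ ≤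
      ‖c‖ * (2 * Real.pi) * (2 + 2 / δ₁) * bracket (s - 3) ξ := by
  have hp := elliptic_pos hγ₁ hδ₁ ξ
  have hbs := bracket_pos s ξ
  have hb1 := bracket_pos 1 ξ
  rw [outerSymbol, zero_mul, add_zero, norm_mul, norm_mul, Complex.norm_real,
    Real.norm_of_nonneg (div_nonneg (bracket_pos _ _).le hp.le)]
  calc ‖c‖ * ‖symX ξ‖ * (bracket s ξ / elliptic γ₁ δ₁ ξ)
      ≤ ‖c‖ * (2 * Real.pi * bracket 1 ξ) * ((2 + 2 / δ₁) * bracket (s - 4) ξ) := by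
        gcongr
        · exact norm_symX_le ξ
        · exact bracket_div_elliptic_le hγ₁ hδ₁ ξ
    _ = ‖c‖ * (2 * Real.pi) * (2 + 2 / δ₁) * (bracket 1 ξ * bracket (s - 4) ξ) := by ring
    _ = _ := by rw [bracket_mul]; congr 2; ring

/-- Three derivatives against an elliptic symbol of order four gain one power of the weight. -/
theorem norm_outerSymbol_le (hγ₁ : 0 < γ₁) (hδ₁ : 0 < δ₁) (c₁ c₂ : ℂ) (ξ : ℝ) :
    ‖outerSymbol s γ₁ δ₁ c₁ c₂ ξ‖ ≤
      (‖c₁‖ * (2 * Real.pi) + ‖c₂‖ * (2 * Real.pi) ^ 3) * (2 + 2 / δ₁) * bracket (s - 1) ξ := by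
  have hp := elliptic_pos hγ₁ hδ₁ ξ
  have hbs := bracket_pos s ξ
  have hb3' := bracket_pos 3 ξ
  have hb3 : bracket 1 ξ ^ 3 = bracket 3 ξ := by
    rw [pow_succ, sq, bracket_mul, bracket_mul]
    norm_num
  rw [outerSymbol, norm_mul, Complex.norm_real,
    Real.norm_of_nonneg (div_nonneg (bracket_pos _ _).le hp.le)]
  calc ‖c₁ * symX ξ + c₂ * symX ξ ^ 3‖ * (bracket s ξ / elliptic γ₁ δ₁ ξ)
      ≤ ((‖c₁‖ * (2 * Real.pi) + ‖c₂‖ * (2 * Real.pi) ^ 3) * bracket 3 ξ) *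
          ((2 + 2 / δ₁) * bracket (s - 4) ξ) := by
        gcongr
        · calc ‖c₁ * symX ξ + c₂ * symX ξ ^ 3‖
              ≤ ‖c₁‖ * ‖symX ξ‖ + ‖c₂‖ * ‖symX ξ‖ ^ 3 := by
                refine (norm_add_le _ _).trans (le_of_eq ?_)
                rw [norm_mul, norm_mul, norm_pow]
            _ ≤ ‖c₁‖ * (2 * Real.pi * bracket 3 ξ) + ‖c₂‖ * (2 * Real.pi * bracket 1 ξ) ^ 3 := by
                gcongr
                · refine (norm_symX_le ξ).trans ?_
                  gcongr
                  exact bracket_le_bracket (by norm_num) ξ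
                · exact norm_symX_le ξ
            _ = _ := by rw [mul_pow, hb3]; ring
        · exact bracket_div_elliptic_le hγ₁ hδ₁ ξ
    _ = (‖c₁‖ * (2 * Real.pi) + ‖c₂‖ * (2 * Real.pi) ^ 3) * (2 + 2 / δ₁) *
          (bracket 3 ξ * bracket (s - 4) ξ) := by ring
    _ = _ := by rw [bracket_mul]; congr 2; ring

theorem measurable_outerSymbol (c₁ c₂ : ℂ) : Measurable (outerSymbol s γ₁ δ₁ c₁ c₂) := by
  have h : Measurable (elliptic γ₁ δ₁) := continuous_elliptic.measurable
  have h2 := measurable_bracket s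
  have h3 := measurable_symX
  unfold outerSymbol
  fun_prop

/-! ### The nonlinear terms -/

/-- Peetre's inequality distributes the outer weight of order s-1 over both factors. It cancels the
decay of `q` and leaves (1+|ζ|²)^{-1/2} from `p`. Here s ≥ 1 makes the exponent in Peetre's
inequality nonnegative. -/
theorem isBilinKernel_mul_left {m p q : ℝ → ℂ} (hs : 1 ≤ s) (hm : Measurable m) (hp : Measurable p)
    (hq : Measurable q) {c : ℝ} (hmb : ∀ ξ, ‖m ξ‖ ≤ c * bracket (s - 1) ξ)
    (hpb : ∀ ξ, ‖p ξ‖ ≤ bracket (-s) ξ) (hqb : ∀ ξ, ‖q ξ‖ ≤ bracket (-(s - 1)) ξ) :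
    IsBilinKernel fun ξ ζ => m ξ * (p ζ * q (ξ - ζ)) := by
  have hc : 0 ≤ c := nonneg_of_mul_nonneg_left ((norm_nonneg _).trans (hmb 0)) (bracket_pos _ _)
  refine isBilinKernel_of_le_left (c := c * 2 ^ ((s - 1) / 2)) ?_ fun ξ ζ => ?_
  · exact (hm.comp measurable_fst).mul ((hp.comp measurable_snd).mul
      (hq.comp (measurable_fst.sub measurable_snd)))
  · rw [norm_mul, norm_mul]
    calc ‖m ξ‖ * (‖p ζ‖ * ‖q (ξ - ζ)‖)
        ≤ (c * (2 ^ ((s - 1) / 2) * (bracket (s - 1) ζ * bracket (s - 1) (ξ - ζ)))) *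
            (bracket (-s) ζ * bracket (-(s - 1)) (ξ - ζ)) := by
          gcongr
          · exact mul_nonneg hc (mul_nonneg (by positivity)
              (mul_nonneg (bracket_pos _ _).le (bracket_pos _ _).le))
          · exact (hmb ξ).trans
              (mul_le_mul_of_nonneg_left (bracket_le_mul (by linarith) ξ ζ) hc)
          · exact (bracket_pos _ _).le
          · exact hpb ζ
          · exact hqb _
      _ = c * 2 ^ ((s - 1) / 2) * (bracket (s - 1) ζ * bracket (-s) ζ) *
            (bracket (s - 1) (ξ - ζ) * bracket (-(s - 1)) (ξ - ζ)) := by ring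
      _ = _ := by
          rw [bracket_mul, bracket_mul, add_neg_cancel, bracket_zero, mul_one]
          congr 2
          ring

/-- Both inner symbols decay only to order s-1, so Peetre's inequality cancels them entirely. The
remaining power -1 of the outer weight stays in the output variable. -/
theorem isBilinKernel_mul_right {m p : ℝ → ℂ} (hs : 1 ≤ s) (hm : Measurable m) (hp : Measurable p)
    {c d : ℝ} (hmb : ∀ ξ, ‖m ξ‖ ≤ c * bracket (s - 2) ξ)
    (hpb : ∀ ξ, ‖p ξ‖ ≤ d * bracket (-(s - 1)) ξ) :
    IsBilinKernel fun ξ ζ => m ξ * (p ζ * p (ξ - ζ)) := by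
  have hc : 0 ≤ c := nonneg_of_mul_nonneg_left ((norm_nonneg _).trans (hmb 0)) (bracket_pos _ _)
  have hd : 0 ≤ d := nonneg_of_mul_nonneg_left ((norm_nonneg _).trans (hpb 0)) (bracket_pos _ _)
  refine isBilinKernel_of_le_right (c := c * d ^ 2 * 2 ^ ((s - 1) / 2)) ?_ fun ξ ζ => ?_
  · exact (hm.comp measurable_fst).mul ((hp.comp measurable_snd).mul
      (hp.comp (measurable_fst.sub measurable_snd)))
  · rw [norm_mul, norm_mul]
    calc ‖m ξ‖ * (‖p ζ‖ * ‖p (ξ - ζ)‖)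
        ≤ (c * (bracket (-1) ξ *
            (2 ^ ((s - 1) / 2) * (bracket (s - 1) ζ * bracket (s - 1) (ξ - ζ))))) *
            ((d * bracket (-(s - 1)) ζ) * (d * bracket (-(s - 1)) (ξ - ζ))) := by
          have hb := fun a x => (bracket_pos a x).le
          gcongr
          · exact mul_nonneg hc (mul_nonneg (hb _ _) (mul_nonneg (by positivity)
              (mul_nonneg (hb _ _) (hb _ _))))
          · refine (hmb ξ).trans (mul_le_mul_of_nonneg_left ?_ hc)
            rw [show s - 2 = -1 + (s - 1) by ring, ← bracket_mul]
            exact mul_le_mul_of_nonneg_left (bracket_le_mul (by linarith) ξ ζ) (hb _ _)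
          · exact mul_nonneg hd (hb _ _)
          · exact hpb ζ
          · exact hpb _
      _ = c * d ^ 2 * 2 ^ ((s - 1) / 2) * (bracket (s - 1) ζ * bracket (-(s - 1)) ζ) *
            (bracket (s - 1) (ξ - ζ) * bracket (-(s - 1)) (ξ - ζ)) * bracket (-1) ξ := by ring
      _ = _ := by
          rw [bracket_mul, bracket_mul, add_neg_cancel, bracket_zero, bracket_zero, mul_one,
            mul_one]

/-- The weight `(1 + |ξ|²)^{a/2}` as a complex-valued function. -/
def cbracket (a ξ : ℝ) : ℂ := ((bracket a ξ : ℝ) : ℂ)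

theorem measurable_cbracket (a : ℝ) : Measurable (cbracket a) :=
  Complex.measurable_ofReal.comp (measurable_bracket a)

theorem norm_cbracket (a ξ : ℝ) : ‖cbracket a ξ‖ = bracket a ξ := by
  rw [cbracket, Complex.norm_real, Real.norm_of_nonneg (bracket_pos _ _).le]

theorem cbracket_mul (a b ξ : ℝ) : cbracket a ξ * cbracket b ξ = cbracket (a + b) ξ := by
  rw [cbracket, cbracket, cbracket, ← Complex.ofReal_mul, bracket_mul]

@[simp] theorem cbracket_zero (ξ : ℝ) : cbracket 0 ξ = 1 := by simp [cbracket]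

/-- The symbol that takes `(1 + |ξ|²)^{s/2} û` to the Fourier transform of `∂ₓ u`. -/
def derivSymbol (s ξ : ℝ) : ℂ := symX ξ * cbracket (-s) ξ

theorem measurable_derivSymbol (s : ℝ) : Measurable (derivSymbol s) :=
  measurable_symX.mul (measurable_cbracket _)

theorem norm_derivSymbol_le (s ξ : ℝ) :
    ‖derivSymbol s ξ‖ ≤ 2 * Real.pi * bracket (-(s - 1)) ξ := by
  rw [derivSymbol, norm_mul, norm_cbracket]
  calc ‖symX ξ‖ * bracket (-s) ξ ≤ 2 * Real.pi * bracket 1 ξ * bracket (-s) ξ :=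
        mul_le_mul_of_nonneg_right (norm_symX_le ξ) (bracket_pos _ _).le
    _ = _ := by rw [mul_assoc, bracket_mul]; congr 2; ring

theorem memLp_derivSymbol (hs : 1 ≤ s) : MemLp (derivSymbol s) ∞ volume := by
  refine memLp_top_of_bound (measurable_derivSymbol s).aestronglyMeasurable (2 * Real.pi)
    (Filter.Eventually.of_forall fun ξ => (norm_derivSymbol_le s ξ).trans ?_)
  exact mul_le_of_le_one_right (by positivity) (bracket_le_one (by linarith) ξ)

theorem memLp_cbracket {a : ℝ} (ha : a ≤ 0) : MemLp (cbracket a) ∞ volume := memLp_bracket ha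

theorem isBilinKernel_quadratic (hs : 1 ≤ s) (hγ₁ : 0 < γ₁) (hδ₁ : 0 < δ₁) (c₁ c₂ : ℂ) :
    IsBilinKernel fun ξ ζ =>
      outerSymbol s γ₁ δ₁ c₁ c₂ ξ * (cbracket (-s) ζ * cbracket (-s) (ξ - ζ)) :=
  isBilinKernel_mul_left hs (measurable_outerSymbol _ _) (measurable_cbracket _)
    (measurable_cbracket _) (norm_outerSymbol_le hγ₁ hδ₁ c₁ c₂)
    (fun ξ => (norm_cbracket _ ξ).le)
    (fun ξ => (norm_cbracket _ ξ).trans_le (bracket_le_bracket (by linarith) ξ))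

theorem isBilinKernel_cubic (hs : 1 ≤ s) (hγ₁ : 0 < γ₁) (hδ₁ : 0 < δ₁) (c₁ c₂ : ℂ) :
    IsBilinKernel fun ξ ζ =>
      outerSymbol s γ₁ δ₁ c₁ c₂ ξ * (cbracket (-s) ζ * cbracket (-(s - 1)) (ξ - ζ)) :=
  isBilinKernel_mul_left hs (measurable_outerSymbol _ _) (measurable_cbracket _)
    (measurable_cbracket _) (norm_outerSymbol_le hγ₁ hδ₁ c₁ c₂)
    (fun ξ => (norm_cbracket _ ξ).le) (fun ξ => (norm_cbracket _ ξ).le)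

/-- The inner operator of the cubic term: it puts û * û into `L²` with the weight of order s-1,
which is all that `isBilinKernel_cubic` asks of its second factor. -/
theorem isBilinKernel_square (hs : 1 ≤ s) :
    IsBilinKernel fun ξ ζ => cbracket (s - 1) ξ * (cbracket (-s) ζ * cbracket (-s) (ξ - ζ)) :=
  isBilinKernel_mul_left hs (measurable_cbracket _) (measurable_cbracket _)
    (measurable_cbracket _) (c := 1) (fun ξ => by rw [norm_cbracket, one_mul])
    (fun ξ => (norm_cbracket _ ξ).le)
    (fun ξ => (norm_cbracket _ ξ).trans_le (bracket_le_bracket (by linarith) ξ))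

theorem isBilinKernel_deriv (hs : 1 ≤ s) (hγ₁ : 0 < γ₁) (hδ₁ : 0 < δ₁) (c : ℂ) :
    IsBilinKernel fun ξ ζ =>
      outerSymbol s γ₁ δ₁ c 0 ξ * (derivSymbol s ζ * derivSymbol s (ξ - ζ)) :=
  isBilinKernel_mul_right hs (measurable_outerSymbol _ _) (measurable_derivSymbol s)
    (c := ‖c‖ * (2 * Real.pi) * (2 + 2 / δ₁))
    -- The symbol has order s-3; one more power of decay than needed is given away.
    (fun ξ => (norm_outerSymbol_le_one hγ₁ hδ₁ c ξ).trans
      (mul_le_mul_of_nonneg_left (bracket_le_bracket (by linarith) ξ) (by positivity)))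
    (norm_derivSymbol_le s)

/-- The nonlinear part of the equation, acting on `(1 + |ξ|²)^{s/2} η̂`. -/
def nonlinearity (γ : ℝ) (hs : 1 ≤ s) (hγ₁ : 0 < γ₁) (hδ₁ : 0 < δ₁) (g : L2) : L2 :=
  (isBilinKernel_quadratic hs hγ₁ hδ₁ (-(3 / 4)) (-γ)).bilin g g +
    (isBilinKernel_deriv hs hγ₁ hδ₁ (7 / 48)).bilin g g +
    (isBilinKernel_cubic hs hγ₁ hδ₁ (1 / 8) 0).bilin g ((isBilinKernel_square hs).bilin g g)

end FifthOrderBBM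

end

noncomputable section

namespace FifthOrderBBM

open FourierTransform

/-! ### The equation on the Fourier side -/

variable {s γ₁ δ₁ : ℝ}

/-- The test function `(1 + |ξ|²)^{-s/2} (1 + γ₁ (2πξ)² + δ₁ (2πξ)⁴) ψ`. -/
def timeTest (s γ₁ δ₁ : ℝ) (ψ : 𝓢(ℝ, ℂ)) : L2 :=
  mulOp (cbracket (-s))
    (schwartzL2 (ψ - (γ₁ : ℂ) • (mulX ^ 2) ψ + (δ₁ : ℂ) • (mulX ^ 4) ψ))

/-- The test function `(1 + |ξ|²)^{-s/2} i (2πξ - γ₂ (2πξ)³ + δ₂ (2πξ)⁵) ψ`. -/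
def spaceTest (s γ₂ δ₂ : ℝ) (ψ : 𝓢(ℝ, ℂ)) : L2 :=
  mulOp (cbracket (-s))
    (schwartzL2 (mulX ψ + (γ₂ : ℂ) • (mulX ^ 3) ψ + (δ₂ : ℂ) • (mulX ^ 5) ψ))

theorem coeFn_timeTest (hs : 0 ≤ s) (γ₁ δ₁ : ℝ) (ψ : 𝓢(ℝ, ℂ)) :
    timeTest s γ₁ δ₁ ψ =ᵐ[volume] fun ξ => cbracket (-s) ξ * (elliptic γ₁ δ₁ ξ : ℂ) * ψ ξ := by
  filter_upwards [coeFn_mulOp (memLp_cbracket (neg_nonpos.2 hs))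
    (schwartzL2 (ψ - (γ₁ : ℂ) • (mulX ^ 2) ψ + (δ₁ : ℂ) • (mulX ^ 4) ψ)),
    coeFn_schwartzL2 (ψ - (γ₁ : ℂ) • (mulX ^ 2) ψ + (δ₁ : ℂ) • (mulX ^ 4) ψ)] with ξ h1 h2
  rw [timeTest, h1, h2, add_apply, sub_apply, smul_apply,
    smul_apply, mulX_pow_apply, mulX_pow_apply, mul_pow, mul_pow, Complex.I_sq,
    Complex.I_pow_four, elliptic]
  simp only [smul_eq_mul]
  push_cast
  ring

/-- Up to the factor i, the phase takes the time test function to the space test function. Thus the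
test functions lie in the domain of the generator. -/
theorem coeFn_spaceTest (hs : 0 ≤ s) (hγ₁ : 0 < γ₁) (hδ₁ : 0 < δ₁) (γ₂ δ₂ : ℝ) (ψ : 𝓢(ℝ, ℂ)) :
    spaceTest s γ₂ δ₂ ψ =ᵐ[volume]
      fun ξ => Complex.I * ((phase γ₁ γ₂ δ₁ δ₂ ξ : ℂ) * timeTest s γ₁ δ₁ ψ ξ) := by
  filter_upwards [coeFn_mulOp (memLp_cbracket (neg_nonpos.2 hs))
    (schwartzL2 (mulX ψ + (γ₂ : ℂ) • (mulX ^ 3) ψ + (δ₂ : ℂ) • (mulX ^ 5) ψ)),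
    coeFn_schwartzL2 (mulX ψ + (γ₂ : ℂ) • (mulX ^ 3) ψ + (δ₂ : ℂ) • (mulX ^ 5) ψ),
    coeFn_timeTest hs γ₁ δ₁ ψ] with ξ h1 h2 h3
  have e1 := mulX_pow_apply 1 ψ ξ
  rw [pow_one, pow_one] at e1
  have hI3 : Complex.I ^ 3 = -Complex.I := by rw [pow_succ, Complex.I_sq]; ring
  have hI5 : Complex.I ^ 5 = Complex.I := by rw [pow_succ, Complex.I_pow_four]; ring
  have hne : (elliptic γ₁ δ₁ ξ : ℂ) ≠ 0 := by exact_mod_cast (elliptic_pos hγ₁ hδ₁ ξ).ne'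
  rw [spaceTest, h1, h2, h3, add_apply, add_apply, smul_apply,
    smul_apply, mulX_pow_apply, mulX_pow_apply, e1, mul_pow, mul_pow, hI3, hI5, phase]
  simp only [smul_eq_mul]
  push_cast
  field_simp
  ring

theorem toDist_apply_fourier (hs : 0 ≤ s) (u : Hs s) (ψ : 𝓢(ℝ, ℂ)) :
    Hs.toDist u (𝓕 ψ) = pair (mulOp (cbracket (-s)) (schwartzL2 ψ)) (Hs.hat s u) := by
  rw [Hs.toDist_eq hs, ← Lp.fourierInv_toTemperedDistribution_eq,
    TemperedDistribution.fourierInv_apply, fourierInv_fourier_eq,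
    Lp.toTemperedDistribution_apply, pair_mulOp_left (memLp_cbracket (neg_nonpos.2 hs)), pair_apply]
  refine integral_congr_ae ?_
  filter_upwards [coeFn_schwartzL2 ψ] with x hx
  rw [hx, smul_eq_mul]
  rfl

theorem timeTerm_apply_fourier (hs : 0 ≤ s) (γ₁ δ₁ : ℝ) (u : Hs s) (ψ : 𝓢(ℝ, ℂ)) :
    timeTerm γ₁ δ₁ (Hs.toDist u) (𝓕 ψ) = pair (timeTest s γ₁ δ₁ ψ) (Hs.hat s u) := by
  rw [timeTest, ← toDist_apply_fourier hs, sub_eq_add_neg, ← neg_smul, FourierAdd.fourier_add,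
    FourierAdd.fourier_add, FourierTransform.fourier_smul, FourierTransform.fourier_smul,
    map_add, map_add, map_smul, map_smul, ← dx_pow_apply_fourier, ← dx_pow_apply_fourier, neg_smul,
    ← sub_eq_add_neg]
  rfl

/-- The function `u`. -/
def funOf (u : Hs s) : L2 := 𝓕⁻ (mulOp (cbracket (-s)) (Hs.hat s u))

/-- The function `∂ₓ u`. -/
def derivOf (u : Hs s) : L2 := 𝓕⁻ (mulOp (derivSymbol s) (Hs.hat s u))

theorem l2Fun_toDist (hs : 0 ≤ s) (u : Hs s) : l2Fun (Hs.toDist u) = funOf u := by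
  rw [Hs.toDist_eq hs, l2Fun_coe]
  rfl

theorem dx_toDist (hs : 1 ≤ s) (u : Hs s) : dx (Hs.toDist u) = (derivOf u : 𝓢'(ℝ, ℂ)) := by
  ext φ
  obtain ⟨ψ, rfl⟩ : ∃ ψ : 𝓢(ℝ, ℂ), φ = 𝓕 ψ := ⟨𝓕⁻ φ, (fourier_fourierInv_eq φ).symm⟩
  have h := dx_pow_apply_fourier 1 (Hs.toDist u) ψ
  rw [pow_one, pow_one] at h
  rw [h, toDist_apply_fourier (by linarith), derivOf, ← Lp.fourierInv_toTemperedDistribution_eq,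
    TemperedDistribution.fourierInv_apply, fourierInv_fourier_eq,
    Lp.toTemperedDistribution_apply, pair_mulOp_left (memLp_cbracket (by linarith)), pair_apply]
  refine integral_congr_ae ?_
  filter_upwards [coeFn_schwartzL2 (mulX ψ), coeFn_mulOp (memLp_cbracket (by linarith : -s ≤ 0))
    (Hs.hat s u), coeFn_mulOp (memLp_derivSymbol hs) (Hs.hat s u)] with x h1 h2 h3
  have e1 := mulX_pow_apply 1 ψ x
  rw [pow_one, pow_one] at e1
  rw [h1, h2, h3, e1, smul_eq_mul, derivSymbol, symX]
  ring

theorem l2Fun_dx_toDist (hs : 1 ≤ s) (u : Hs s) : l2Fun (dx (Hs.toDist u)) = derivOf u := by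
  rw [dx_toDist hs, l2Fun_coe]

theorem integrable_mul (f g : L2) : Integrable fun x => f x * g x :=
  MemLp.integrable_mul (Lp.memLp f) (Lp.memLp g)

theorem integrable_sq (f : L2) : Integrable fun x => f x ^ 2 := by
  simpa only [sq] using integrable_mul f f

/-- The elliptic symbol in the test function cancels the denominator of the outer symbol, and the
two weights of order s cancel as well. Only the derivatives outside the nonlinear term remain. -/
theorem timeTest_mul_outerSymbol (hs : 0 ≤ s) (hγ₁ : 0 < γ₁) (hδ₁ : 0 < δ₁) (c₁ c₂ : ℂ)
    (ψ : 𝓢(ℝ, ℂ)) :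
    ∀ᵐ ξ, timeTest s γ₁ δ₁ ψ ξ * outerSymbol s γ₁ δ₁ c₁ c₂ ξ =
      (c₁ • mulX ψ + c₂ • (mulX ^ 3) ψ) ξ := by
  filter_upwards [coeFn_timeTest hs γ₁ δ₁ ψ] with ξ h1
  have e1 := mulX_pow_apply 1 ψ ξ
  rw [pow_one, pow_one] at e1
  have hne : (elliptic γ₁ δ₁ ξ : ℂ) ≠ 0 := by exact_mod_cast (elliptic_pos hγ₁ hδ₁ ξ).ne'
  have hb : cbracket (-s) ξ * ((bracket s ξ : ℝ) : ℂ) = 1 := by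
    have := cbracket_mul (-s) s ξ
    simpa [cbracket] using this
  rw [h1, add_apply, smul_apply, smul_apply, mulX_pow_apply,
    e1, outerSymbol, ← symX, Complex.ofReal_div]
  simp only [smul_eq_mul]
  field_simp
  linear_combination (ψ ξ * symX ξ * (c₁ + c₂ * symX ξ ^ 2)) * hb

/-- The cubic term is evaluated as u·u², so the pointwise square must be recognised as the function
built by the inner kernel. Both are locally integrable and agree on all smooth compactly supported
tests. -/
theorem sq_funOf (hs : 1 ≤ s) (u : Hs s) :
    (fun x => funOf u x ^ 2) =ᵐ[volume] (𝓕⁻ (mulOp (cbracket (-(s - 1)))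
      ((isBilinKernel_square hs).bilin (Hs.hat s u) (Hs.hat s u))) : L2) := by
  set w : L2 := 𝓕⁻ (mulOp (cbracket (-(s - 1)))
      ((isBilinKernel_square hs).bilin (Hs.hat s u) (Hs.hat s u))) with hw
  refine ae_eq_of_integral_contDiff_smul_eq (integrable_sq _).locallyIntegrable
    ((Lp.memLp w).locallyIntegrable (by norm_num)) fun χ hχ hc => ?_
  have hg₁ : HasCompactSupport (Complex.ofRealCLM ∘ χ) := hc.comp_left rfl
  have hg₂ : ContDiff ℝ ∞ (Complex.ofRealCLM ∘ χ) := by fun_prop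
  set Ψ : 𝓢(ℝ, ℂ) := 𝓕⁻ (hg₁.toSchwartzMap hg₂) with hΨ
  have hF : 𝓕 Ψ = hg₁.toSchwartzMap hg₂ := fourier_fourierInv_eq _
  have hneg : -(s - 1) ≤ 0 := by linarith
  have h1 := pair_fourierInv_mulOp (isBilinKernel_square hs)
    (memLp_cbracket (by linarith : -s ≤ 0)) (memLp_cbracket (by linarith : -s ≤ 0))
    (Hs.hat s u) (Hs.hat s u) (mulOp (cbracket (-(s - 1))) (schwartzL2 Ψ)) Ψ (by
      filter_upwards [coeFn_mulOp (memLp_cbracket hneg) (schwartzL2 Ψ), coeFn_schwartzL2 Ψ]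
        with ξ h1 h2
      rw [h1, h2]
      have := cbracket_mul (-(s - 1)) (s - 1) ξ
      rw [neg_add_cancel, cbracket_zero] at this
      linear_combination Ψ ξ * this)
  have h2 : (w : 𝓢'(ℝ, ℂ)) (𝓕 Ψ) = pair (mulOp (cbracket (-(s - 1))) (schwartzL2 Ψ))
      ((isBilinKernel_square hs).bilin (Hs.hat s u) (Hs.hat s u)) := by
    rw [hw, ← Lp.fourierInv_toTemperedDistribution_eq,
      TemperedDistribution.fourierInv_apply, fourierInv_fourier_eq,
      Lp.toTemperedDistribution_apply, pair_mulOp_left (memLp_cbracket hneg), pair_apply]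
    refine integral_congr_ae ?_
    filter_upwards [coeFn_schwartzL2 Ψ] with x hx
    rw [hx, smul_eq_mul]
  rw [Lp.toTemperedDistribution_apply, ← h1] at h2
  rw [hF] at h2
  convert! h2.symm using 1
  refine integral_congr_ae (Filter.Eventually.of_forall fun x => ?_)
  simp [funOf, sq]

theorem pair_timeTest_bilin (hs : 0 ≤ s) (hγ₁ : 0 < γ₁) (hδ₁ : 0 < δ₁) {c₁ c₂ : ℂ} {p q : ℝ → ℂ}
    (hk : IsBilinKernel fun ξ ζ => outerSymbol s γ₁ δ₁ c₁ c₂ ξ * (p ζ * q (ξ - ζ)))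
    (hp : MemLp p ∞ volume) (hq : MemLp q ∞ volume) (f g : L2) {P : ℝ → ℂ}
    (hP : P =ᵐ[volume] fun x => (𝓕⁻ (mulOp p f) : L2) x * (𝓕⁻ (mulOp q g) : L2) x)
    (ψ : 𝓢(ℝ, ℂ)) :
    pair (timeTest s γ₁ δ₁ ψ) (hk.bilin f g) =
      c₁ * ofL1 P (𝓕 (mulX ψ)) + c₂ * ofL1 P (𝓕 ((mulX ^ 3) ψ)) := by
  rw [← pair_fourierInv_mulOp hk hp hq f g (timeTest s γ₁ δ₁ ψ) _
    (timeTest_mul_outerSymbol hs hγ₁ hδ₁ c₁ c₂ ψ)]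
  have h : ∀ Ψ : 𝓢(ℝ, ℂ), ∫ x, (𝓕 Ψ) x * ((𝓕⁻ (mulOp p f) : L2) x *
      (𝓕⁻ (mulOp q g) : L2) x) = ofL1 P (𝓕 Ψ) := by
    intro Ψ
    rw [ofL1_apply ((integrable_mul _ _).congr hP.symm)]
    refine integral_congr_ae ?_
    filter_upwards [hP] with x hx
    rw [hx]
  rw [h, FourierAdd.fourier_add, FourierTransform.fourier_smul, FourierTransform.fourier_smul,
    map_add, map_smul, map_smul, smul_eq_mul, smul_eq_mul]

theorem pair_timeTest_nonlinearity (γ : ℝ) (hs : 1 ≤ s) (hγ₁ : 0 < γ₁) (hδ₁ : 0 < δ₁)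
    (u : Hs s) (ψ : 𝓢(ℝ, ℂ)) :
    pair (timeTest s γ₁ δ₁ ψ) (nonlinearity γ hs hγ₁ hδ₁ (Hs.hat s u)) =
      -((3 / 4 : ℂ) * ofL1 (fun x => funOf u x ^ 2) (𝓕 (mulX ψ)) +
        (γ : ℂ) * ofL1 (fun x => funOf u x ^ 2) (𝓕 ((mulX ^ 3) ψ))) +
      (7 / 48 : ℂ) * ofL1 (fun x => derivOf u x ^ 2) (𝓕 (mulX ψ)) +
      (1 / 8 : ℂ) * ofL1 (fun x => funOf u x ^ 3) (𝓕 (mulX ψ)) := by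
  have hs0 : 0 ≤ s := by linarith
  have hmb := memLp_cbracket (by linarith : -s ≤ 0)
  rw [nonlinearity, map_add, map_add,
    pair_timeTest_bilin hs0 hγ₁ hδ₁ _ hmb hmb (Hs.hat s u) (Hs.hat s u)
      (P := fun x => funOf u x ^ 2) (Filter.Eventually.of_forall fun x => sq _),
    pair_timeTest_bilin hs0 hγ₁ hδ₁ _ (memLp_derivSymbol hs) (memLp_derivSymbol hs)
      (Hs.hat s u) (Hs.hat s u)
      (P := fun x => derivOf u x ^ 2) (Filter.Eventually.of_forall fun x => sq _),
    pair_timeTest_bilin hs0 hγ₁ hδ₁ _ hmb (memLp_cbracket (by linarith : -(s - 1) ≤ 0))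
      (Hs.hat s u) _ (P := fun x => funOf u x ^ 3) ?_]
  · ring
  · filter_upwards [sq_funOf hs u] with x hx
    rw [pow_succ, hx, mul_comm]
    rfl

theorem pair_spaceTest (hs : 0 ≤ s) (γ₂ δ₂ : ℝ) (u : Hs s) (ψ : 𝓢(ℝ, ℂ)) :
    pair (spaceTest s γ₂ δ₂ ψ) (Hs.hat s u) = Hs.toDist u (𝓕 (mulX ψ)) +
      (γ₂ : ℂ) * Hs.toDist u (𝓕 ((mulX ^ 3) ψ)) + (δ₂ : ℂ) * Hs.toDist u (𝓕 ((mulX ^ 5) ψ)) := by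
  rw [spaceTest, ← toDist_apply_fourier hs, FourierAdd.fourier_add, FourierAdd.fourier_add,
    FourierTransform.fourier_smul, FourierTransform.fourier_smul, map_add, map_add, map_smul,
    map_smul, smul_eq_mul, smul_eq_mul]

theorem spaceTerm_apply (γ₂ δ₂ γ : ℝ) (F : 𝓢'(ℝ, ℂ)) (φ : 𝓢(ℝ, ℂ)) :
    spaceTerm γ₂ δ₂ γ F φ = dx F φ + (γ₂ : ℂ) * (dx ^ 3) F φ + (δ₂ : ℂ) * (dx ^ 5) F φ +
      (3 / 4 : ℂ) * dx (ofL1 fun x => l2Fun F x ^ 2) φ +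
      (γ : ℂ) * (dx ^ 3) (ofL1 fun x => l2Fun F x ^ 2) φ -
      (7 / 48 : ℂ) * dx (ofL1 fun x => l2Fun (dx F) x ^ 2) φ -
      (1 / 8 : ℂ) * dx (ofL1 fun x => l2Fun F x ^ 3) φ :=
  rfl

/-- Here the partial differential equation becomes the ordinary one: in this pairing the spatial
terms are iφ·g - N(g), tested with `timeTest`. -/
theorem spaceTerm_apply_fourier (γ γ₂ δ₂ : ℝ) (hs : 1 ≤ s) (hγ₁ : 0 < γ₁) (hδ₁ : 0 < δ₁)
    (u : Hs s) (ψ : 𝓢(ℝ, ℂ)) :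
    spaceTerm γ₂ δ₂ γ (Hs.toDist u) (𝓕 ψ) = pair (spaceTest s γ₂ δ₂ ψ) (Hs.hat s u) -
      pair (timeTest s γ₁ δ₁ ψ) (nonlinearity γ hs hγ₁ hδ₁ (Hs.hat s u)) := by
  have hs0 : 0 ≤ s := by linarith
  have hdx : ∀ F : 𝓢'(ℝ, ℂ), dx F (𝓕 ψ) = F (𝓕 (mulX ψ)) := fun F => by
    simpa only [pow_one] using dx_pow_apply_fourier 1 F ψ
  rw [pair_timeTest_nonlinearity, pair_spaceTest hs0]
  rw [spaceTerm_apply, l2Fun_toDist hs0, l2Fun_dx_toDist hs, hdx, hdx, hdx, hdx,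
    dx_pow_apply_fourier, dx_pow_apply_fourier, dx_pow_apply_fourier]
  ring

end FifthOrderBBM

end

noncomputable section

namespace FifthOrderBBM

open FourierTransform

/-! ### Weak derivatives in time -/

theorem eq_add_integral_iff_hasDerivWithinAt {E : Type*} [NormedAddCommGroup E] [NormedSpace ℝ E]
    [CompleteSpace E] {f f' : ℝ → E} {T : ℝ} (hf' : Continuous f') :
    (∀ t ∈ Set.Icc 0 T, f t = f 0 + ∫ τ in (0 : ℝ)..t, f' τ) ↔
      ∀ t ∈ Set.Icc 0 T, HasDerivWithinAt f (f' t) (Set.Icc 0 T) t := by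
  constructor
  · intro h t ht
    have h1 : HasDerivAt (fun t => f 0 + ∫ τ in (0 : ℝ)..t, f' τ) (f' t) t :=
      (intervalIntegral.integral_hasDerivAt_right (hf'.intervalIntegrable _ _)
        hf'.aestronglyMeasurable.stronglyMeasurableAtFilter hf'.continuousAt).const_add _
    exact h1.hasDerivWithinAt.congr h (h t ht)
  · intro h t ht
    have h1 := intervalIntegral.integral_eq_sub_of_hasDerivAt_of_le (f := f) (f' := f') ht.1
      (fun u hu => ((h u ⟨hu.1, hu.2.trans ht.2⟩).continuousWithinAt).mono
        (Set.Icc_subset_Icc_right ht.2))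
      (fun u hu => (h u ⟨hu.1.le, hu.2.le.trans ht.2⟩).hasDerivAt
        (Icc_mem_nhds hu.1 (hu.2.trans_le ht.2))) (hf'.intervalIntegrable _ _)
    rw [h1]
    abel

theorem exists_Icc_of_isCompact_subset_Ioo {K : Set ℝ} {a b : ℝ} (hK : IsCompact K) (hab : a < b)
    (h : K ⊆ Set.Ioo a b) : ∃ c d, a < c ∧ c ≤ d ∧ d < b ∧ K ⊆ Set.Icc c d := by
  rcases K.eq_empty_or_nonempty with rfl | hne
  · exact ⟨(a + b) / 2, (a + b) / 2, by linarith, le_rfl, by linarith, Set.empty_subset _⟩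
  · have h1 := hK.sInf_mem hne
    have h2 := hK.sSup_mem hne
    exact ⟨sInf K, sSup K, (h h1).1, csInf_le hK.bddBelow h2, (h h2).2,
      fun x hx => ⟨csInf_le hK.bddBelow hx, le_csSup hK.bddAbove hx⟩⟩

/-- The primitive from 0 vanishes to the left of the support trivially, and to the right of it
because the total integral is zero. -/
theorem exists_primitive_of_integral_eq_zero {θ : ℝ → ℝ} {T : ℝ} (hT : 0 < T)
    (hθ : ContDiff ℝ ∞ θ) (hc : HasCompactSupport θ) (hs : tsupport θ ⊆ Set.Ioo 0 T)
    (h0 : ∫ t in (0 : ℝ)..T, θ t = 0) :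
    ∃ χ : ℝ → ℝ, ContDiff ℝ ∞ χ ∧ HasCompactSupport χ ∧ tsupport χ ⊆ Set.Ioo 0 T ∧
      deriv χ = θ := by
  obtain ⟨a, b, ha, hab, hb, hK⟩ := exists_Icc_of_isCompact_subset_Ioo hc hT hs
  have hz : ∀ t, t ∉ Set.Icc a b → θ t = 0 := fun t ht => image_eq_zero_of_notMem_tsupport
    fun h => ht (hK h)
  have hd : ∀ t, HasDerivAt (fun t => ∫ τ in (0 : ℝ)..t, θ τ) (θ t) t := fun t =>
    intervalIntegral.integral_hasDerivAt_right (hθ.continuous.intervalIntegrable _ _)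
      hθ.continuous.aestronglyMeasurable.stronglyMeasurableAtFilter hθ.continuous.continuousAt
  have hderiv : deriv (fun t => ∫ τ in (0 : ℝ)..t, θ τ) = θ := funext fun t => (hd t).deriv
  have hsupp : Function.support (fun t => ∫ τ in (0 : ℝ)..t, θ τ) ⊆ Set.Icc a b := by
    intro t ht
    by_contra hn
    apply ht
    rcases not_and_or.1 hn with h | h
    · have : ∫ τ in (0 : ℝ)..t, θ τ = ∫ τ in (0 : ℝ)..t, 0 := by
        refine intervalIntegral.integral_congr fun τ hτ => hz τ fun h' => ?_
        have := hτ.2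
        have := h'.1
        rcases max_cases 0 t with h | h <;> linarith
      simpa using this
    · have h1 : ∫ τ in t..T, θ τ = ∫ τ in t..T, 0 := by
        refine intervalIntegral.integral_congr fun τ hτ => hz τ fun h' => ?_
        have := hτ.1
        have := h'.2
        rcases min_cases t T with h | h <;> linarith
      have h2 := intervalIntegral.integral_add_adjacent_intervals
        (hθ.continuous.intervalIntegrable (μ := volume) 0 t)
        (hθ.continuous.intervalIntegrable (μ := volume) t T)
      rw [h0, h1] at h2
      simpa using h2
  have hts : tsupport (fun t => ∫ τ in (0 : ℝ)..t, θ τ) ⊆ Set.Icc a b :=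
    closure_minimal hsupp isClosed_Icc
  refine ⟨_, ?_, HasCompactSupport.of_support_subset_isCompact isCompact_Icc hsupp,
    hts.trans fun t ht => ⟨ha.trans_le ht.1, ht.2.trans_lt hb⟩, hderiv⟩
  exact contDiff_infty_iff_deriv.2 ⟨fun t => (hd t).differentiableAt, by rw [hderiv]; exact hθ⟩

theorem integral_eq_intervalIntegral_of_tsupport {χ : ℝ → ℝ} {T : ℝ}
    (hs : tsupport χ ⊆ Set.Ioo 0 T) (A : ℝ → ℂ) :
    ∫ t, χ t • A t = ∫ t in (0 : ℝ)..T, (χ t : ℂ) * A t := by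
  rw [intervalIntegral.integral_eq_integral_of_support_subset]
  · simp only [Complex.real_smul]
  · intro t ht
    have : χ t ≠ 0 := fun h => ht (by simp [h])
    exact Set.Ioo_subset_Ioc_self (hs (subset_tsupport χ this))

/-- The lemma of du Bois-Reymond. -/
theorem eqOn_const_of_integral_deriv_mul_eq_zero {D : ℝ → ℂ} {T : ℝ} (hT : 0 < T)
    (hD : Continuous D)
    (h : ∀ χ : ℝ → ℝ, ContDiff ℝ ∞ χ → HasCompactSupport χ → tsupport χ ⊆ Set.Ioo 0 T →
      ∫ t in (0 : ℝ)..T, ((deriv χ t : ℝ) : ℂ) * D t = 0) :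
    ∀ t ∈ Set.Icc 0 T, D t = D 0 := by
  -- The support is [T/4, 3T/4], well inside (0,T).
  let bump : ContDiffBump (T / 2) := ⟨T / 8, T / 4, by positivity, by linarith⟩
  set θ₀ : ℝ → ℝ := bump.normed volume with hθ₀
  have hb1 : ContDiff ℝ ∞ θ₀ := bump.contDiff_normed
  have hb2 : HasCompactSupport θ₀ := bump.hasCompactSupport_normed
  have hb3 : tsupport θ₀ ⊆ Set.Ioo 0 T := by
    rw [hθ₀, bump.tsupport_normed_eq, Real.closedBall_eq_Icc]
    intro t ht
    have h1 : T / 2 - T / 4 ≤ t := ht.1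
    have h2 : t ≤ T / 2 + T / 4 := ht.2
    constructor <;> linarith
  have hb4 : ∫ t in (0 : ℝ)..T, θ₀ t = 1 := by
    rw [intervalIntegral.integral_eq_integral_of_support_subset
      (((subset_tsupport θ₀).trans hb3).trans Set.Ioo_subset_Ioc_self)]
    exact bump.integral_normed
  set c := ∫ t in (0 : ℝ)..T, (θ₀ t : ℂ) * D t with hc
  have key : ∀ᵐ t, t ∈ Set.Ioo 0 T → D t - c = 0 := by
    refine isOpen_Ioo.ae_eq_zero_of_integral_contDiff_smul_eq_zero
      ((hD.sub continuous_const).locallyIntegrable.locallyIntegrableOn _) fun θ h1 h2 h3 => ?_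
    rw [integral_eq_intervalIntegral_of_tsupport h3]
    set i := ∫ t in (0 : ℝ)..T, θ t with hi
    -- Subtracting the mean times a bump of integral one makes the integral vanish, so the
    -- difference is the derivative of an admissible test function.
    have hθ1 : ContDiff ℝ ∞ fun t => θ t - i * θ₀ t := h1.sub (contDiff_const.mul hb1)
    have hsub : tsupport (fun t => θ t - i * θ₀ t) ⊆ tsupport θ ∪ tsupport θ₀ :=
      (tsupport_sub θ (fun t => i * θ₀ t)).trans
        (Set.union_subset_union_right _ (tsupport_mul_subset_right))
    have hcs : HasCompactSupport fun t => θ t - i * θ₀ t := h2.sub hb2.mul_left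
    obtain ⟨χ, k1, k2, k3, k4⟩ := exists_primitive_of_integral_eq_zero hT hθ1 hcs
      (hsub.trans (Set.union_subset h3 hb3)) (by
        rw [intervalIntegral.integral_sub (h1.continuous.intervalIntegrable _ _)
          ((hb1.continuous.const_mul i).intervalIntegrable _ _),
          intervalIntegral.integral_const_mul, hb4, ← hi]
        ring)
    have h4 := h χ k1 k2 k3
    rw [k4] at h4
    have c1 : Continuous fun t => (θ t : ℂ) * D t :=
      (Complex.continuous_ofReal.comp h1.continuous).mul hD
    have c0 : Continuous fun t => (θ t : ℂ) := Complex.continuous_ofReal.comp h1.continuous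
    have c3 : Continuous fun t => (θ t : ℂ) * c := c0.mul continuous_const
    have c2 : Continuous fun t => (θ₀ t : ℂ) * D t :=
      (Complex.continuous_ofReal.comp hb1.continuous).mul hD
    have e1 : ∫ t in (0 : ℝ)..T, (((θ t - i * θ₀ t : ℝ)) : ℂ) * D t =
        (∫ t in (0 : ℝ)..T, (θ t : ℂ) * D t) - i * c := by
      rw [hc, ← intervalIntegral.integral_const_mul, ← intervalIntegral.integral_sub
        (c1.intervalIntegrable _ _) ((c2.const_mul _).intervalIntegrable _ _)]
      refine intervalIntegral.integral_congr fun t _ => ?_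
      push_cast
      ring
    have e2 : ∫ t in (0 : ℝ)..T, (θ t : ℂ) * (D t - c) =
        (∫ t in (0 : ℝ)..T, (θ t : ℂ) * D t) - i * c := by
      simp_rw [mul_sub]
      rw [intervalIntegral.integral_sub (c1.intervalIntegrable _ _)
        (c3.intervalIntegrable _ _), intervalIntegral.integral_mul_const,
        hi, intervalIntegral.integral_ofReal]
    rw [e2, ← e1, h4]
  have hEq : Set.EqOn D (fun _ => c) (Set.Ioo 0 T) := by
    refine Measure.eqOn_open_of_ae_eq (μ := volume) ?_ isOpen_Ioo hD.continuousOn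
      continuousOn_const
    rw [Filter.EventuallyEq, ae_restrict_iff' measurableSet_Ioo]
    filter_upwards [key] with t ht h't
    exact sub_eq_zero.1 (ht h't)
  have hEq2 := hEq.closure hD continuous_const
  rw [closure_Ioo hT.ne] at hEq2
  intro t ht
  rw [hEq2 ht, hEq2 (Set.left_mem_Icc.2 hT.le)]

/-- Integration by parts shows that the primitive of -B has weak derivative -B. The difference
between A and this primitive then has weak derivative zero and is constant, up to the endpoints by
continuity. -/
theorem weak_deriv_iff {A B : ℝ → ℂ} {T : ℝ} (hT : 0 < T) (hA : Continuous A)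
    (hB : Continuous B) :
    (∀ χ : ℝ → ℝ, ContDiff ℝ ∞ χ → HasCompactSupport χ → tsupport χ ⊆ Set.Ioo 0 T →
      -(∫ t in (0 : ℝ)..T, ((deriv χ t : ℝ) : ℂ) * A t)
        + ∫ t in (0 : ℝ)..T, ((χ t : ℝ) : ℂ) * B t = 0) ↔
      ∀ t ∈ Set.Icc 0 T, A t = A 0 + ∫ τ in (0 : ℝ)..t, -B τ := by
  have hP : ∀ t, HasDerivAt (fun t => ∫ τ in (0 : ℝ)..t, -B τ) (-B t) t := fun t =>
    intervalIntegral.integral_hasDerivAt_right (hB.neg.intervalIntegrable _ _)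
      hB.neg.aestronglyMeasurable.stronglyMeasurableAtFilter hB.neg.continuousAt
  have hPc : Continuous fun t => ∫ τ in (0 : ℝ)..t, -B τ :=
    continuous_iff_continuousAt.2 fun t => (hP t).continuousAt
  have parts : ∀ χ : ℝ → ℝ, ContDiff ℝ ∞ χ → HasCompactSupport χ → tsupport χ ⊆ Set.Ioo 0 T →
      ∀ a : ℂ, ∫ t in (0 : ℝ)..T, ((deriv χ t : ℝ) : ℂ) * (a + ∫ τ in (0 : ℝ)..t, -B τ) =
        ∫ t in (0 : ℝ)..T, ((χ t : ℝ) : ℂ) * B t := by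
    intro χ h1 h2 h3 a
    have hd : ∀ t, HasDerivAt (fun t => ((χ t : ℝ) : ℂ)) ((deriv χ t : ℝ) : ℂ) t := fun t =>
      ((h1.differentiable (by simp)) t).hasDerivAt.ofReal_comp
    have hdc : Continuous fun t => ((deriv χ t : ℝ) : ℂ) :=
      Complex.continuous_ofReal.comp (h1.continuous_deriv (by simp))
    have hz : ∀ t, t ∉ Set.Ioo 0 T → χ t = 0 := fun t ht =>
      image_eq_zero_of_notMem_tsupport fun h => ht (h3 h)
    have := intervalIntegral.integral_deriv_mul_eq_sub (a := 0) (b := T)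
      (fun t _ => hd t) (fun t _ => (hP t).const_add a)
      (hdc.intervalIntegrable _ _) (hB.neg.intervalIntegrable _ _)
    rw [hz 0 (by simp), hz T (by simp)] at this
    have hχc : Continuous fun t => ((χ t : ℝ) : ℂ) := Complex.continuous_ofReal.comp h1.continuous
    have c1 : Continuous fun t => ((deriv χ t : ℝ) : ℂ) * (a + ∫ τ in (0 : ℝ)..t, -B τ) :=
      hdc.mul (continuous_const.add hPc)
    have c2 : Continuous fun t => ((χ t : ℝ) : ℂ) * -B t := hχc.mul hB.neg
    rw [intervalIntegral.integral_add (c1.intervalIntegrable _ _) (c2.intervalIntegrable _ _)]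
      at this
    simp only [mul_neg, intervalIntegral.integral_neg, Complex.ofReal_zero, zero_mul,
      sub_self] at this
    simp only [intervalIntegral.integral_neg]
    linear_combination this
  constructor
  · intro h
    have hD : Continuous fun t => A t - ∫ τ in (0 : ℝ)..t, -B τ := hA.sub hPc
    have := eqOn_const_of_integral_deriv_mul_eq_zero hT hD fun χ h1 h2 h3 => by
      have k1 := h χ h1 h2 h3
      have k2 := parts χ h1 h2 h3 0
      have hdc : Continuous fun t => ((deriv χ t : ℝ) : ℂ) :=
        Complex.continuous_ofReal.comp (h1.continuous_deriv (by simp))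
      have c1 : Continuous fun t => ((deriv χ t : ℝ) : ℂ) * A t := hdc.mul hA
      have c2 : Continuous fun t => ((deriv χ t : ℝ) : ℂ) * ∫ τ in (0 : ℝ)..t, -B τ := hdc.mul hPc
      simp_rw [mul_sub]
      rw [intervalIntegral.integral_sub (c1.intervalIntegrable _ _) (c2.intervalIntegrable _ _)]
      simp_rw [zero_add] at k2
      rw [k2]
      linear_combination -k1
    intro t ht
    have h2 := this t ht
    simp only [intervalIntegral.integral_same, sub_zero] at h2
    linear_combination h2
  · intro h χ h1 h2 h3
    rw [← parts χ h1 h2 h3 (A 0), neg_add_eq_zero]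
    refine intervalIntegral.integral_congr fun t ht => ?_
    rw [Set.uIcc_of_le hT.le] at ht
    rw [h t ht]

end FifthOrderBBM

end

noncomputable section

namespace FifthOrderBBM

open FourierTransform

/-! ### Distributional solutions and mild solutions -/

variable {s γ₁ δ₁ : ℝ}

theorem hasDerivAt_propagator_timeTest (hs : 0 ≤ s) (hγ₁ : 0 < γ₁) (hδ₁ : 0 < δ₁) (γ₂ δ₂ : ℝ)
    (ψ : 𝓢(ℝ, ℂ)) (t : ℝ) :
    HasDerivAt (fun t => propagator (phase γ₁ γ₂ δ₁ δ₂) t (timeTest s γ₁ δ₁ ψ))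
      (propagator (phase γ₁ γ₂ δ₁ δ₂) t (spaceTest s γ₂ δ₂ ψ)) t := by
  have h : ((-Complex.I) • spaceTest s γ₂ δ₂ ψ : L2) =ᵐ[volume]
      fun ξ => (phase γ₁ γ₂ δ₁ δ₂ ξ : ℂ) * timeTest s γ₁ δ₁ ψ ξ := by
    filter_upwards [Lp.coeFn_smul (-Complex.I) (spaceTest s γ₂ δ₂ ψ),
      coeFn_spaceTest hs hγ₁ hδ₁ γ₂ δ₂ ψ] with ξ h1 h2
    rw [h1, Pi.smul_apply, h2, smul_eq_mul]
    linear_combination (-(phase γ₁ γ₂ δ₁ δ₂ ξ : ℂ) * timeTest s γ₁ δ₁ ψ ξ) * Complex.I_mul_I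
  have h2 := hasDerivAt_propagator (measurable_phase γ₁ γ₂ δ₁ δ₂) h t
  rwa [smul_smul, mul_neg, Complex.I_mul_I, neg_neg, one_smul] at h2

/-- Since k(t) = 0, the slope of the product is the slope of `k` paired with `g`, so continuity of
`g` is enough. This matters because a weak solution is not known to be differentiable in `L²`. -/
theorem hasDerivWithinAt_bilin_of_eq_zero {E F G : Type*} [NormedAddCommGroup E] [NormedSpace ℂ E]
    [NormedAddCommGroup F] [NormedSpace ℂ F] [NormedAddCommGroup G] [NormedSpace ℂ G]
    (P : E →L[ℂ] F →L[ℂ] G) {k : ℝ → E} {g : ℝ → F} {k' : E} {S : Set ℝ} {t : ℝ}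
    (hk : HasDerivWithinAt k k' S t) (h0 : k t = 0) (hg : ContinuousWithinAt g S t) :
    HasDerivWithinAt (fun τ => P (k τ) (g τ)) (P k' (g t)) S t := by
  rw [hasDerivWithinAt_iff_tendsto_slope] at hk ⊢
  have hc : Continuous fun p : E × F => P p.1 p.2 :=
    (P.continuous.comp continuous_fst).clm_apply continuous_snd
  have h1 : Filter.Tendsto (fun τ => P (slope k t τ) (g τ)) (𝓝[S \ {t}] t) (𝓝 (P k' (g t))) :=
    (hc.tendsto (k', g t)).comp (hk.prodMk_nhds (hg.mono_left (nhdsWithin_mono _ Set.sdiff_subset)))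
  refine h1.congr fun τ => ?_
  rw [slope_def_module, slope_def_module, h0, sub_zero, map_zero,
    ContinuousLinearMap.map_smul_of_tower]
  simp

theorem hasDerivWithinAt_pair_of_eq_zero {k g : ℝ → L2} {k' : L2} {S : Set ℝ} {t : ℝ}
    (hk : HasDerivWithinAt k k' S t) (h0 : k t = 0) (hg : ContinuousWithinAt g S t) :
    HasDerivWithinAt (fun τ => pair (k τ) (g τ)) (pair k' (g t)) S t :=
  hasDerivWithinAt_bilin_of_eq_zero pair hk h0 hg

/-- The factor multiplying ψ in `timeTest` is continuous and never zero, so compactly supported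
tests already separate points of `L²`. -/
theorem eq_zero_of_pair_timeTest_eq_zero (hs : 0 ≤ s) (hγ₁ : 0 < γ₁) (hδ₁ : 0 < δ₁) {f : L2}
    (h : ∀ ψ : 𝓢(ℝ, ℂ), HasCompactSupport ψ → pair (timeTest s γ₁ δ₁ ψ) f = 0) : f = 0 := by
  rw [Lp.eq_zero_iff_ae_eq_zero]
  have hc : Continuous fun ξ => cbracket (-s) ξ * (elliptic γ₁ δ₁ ξ : ℂ) :=
    (Complex.continuous_ofReal.comp (continuous_bracket _)).mul
      (Complex.continuous_ofReal.comp continuous_elliptic)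
  have hl : LocallyIntegrable (fun ξ => (cbracket (-s) ξ * (elliptic γ₁ δ₁ ξ : ℂ)) * f ξ) volume :=
    ((Lp.memLp f).locallyIntegrable (by norm_num)).continuous_mul hc
  have h0 := ae_eq_zero_of_integral_contDiff_smul_eq_zero hl fun χ hχ hcs => by
    have hg₁ : HasCompactSupport (Complex.ofRealCLM ∘ χ) := hcs.comp_left rfl
    have hg₂ : ContDiff ℝ ∞ (Complex.ofRealCLM ∘ χ) := by fun_prop
    have := h (hg₁.toSchwartzMap hg₂) hg₁
    rw [pair_apply] at this
    rw [← this]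
    refine integral_congr_ae ?_
    filter_upwards [coeFn_timeTest hs γ₁ δ₁ (hg₁.toSchwartzMap hg₂)] with ξ hξ
    rw [hξ]
    simp only [Complex.real_smul, HasCompactSupport.toSchwartzMap_toFun, Function.comp_apply,
      Complex.ofRealCLM_apply]
    ring
  filter_upwards [h0] with ξ hξ
  have h1 : cbracket (-s) ξ ≠ 0 := by
    rw [cbracket]
    exact_mod_cast (bracket_pos _ _).ne'
  have h2 : (elliptic γ₁ δ₁ ξ : ℂ) ≠ 0 := by exact_mod_cast (elliptic_pos hγ₁ hδ₁ ξ).ne'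
  simpa [h1, h2] using hξ

/-- A compactly supported test function, moved by the linear flow. -/
theorem exists_propagated_test (hs : 0 ≤ s) (hγ₁ : 0 < γ₁) (hδ₁ : 0 < δ₁) (γ₂ δ₂ : ℝ)
    {ψ : 𝓢(ℝ, ℂ)} (hψ : HasCompactSupport ψ) (t : ℝ) :
    ∃ ψ' : 𝓢(ℝ, ℂ),
      timeTest s γ₁ δ₁ ψ' = propagator (phase γ₁ γ₂ δ₁ δ₂) t (timeTest s γ₁ δ₁ ψ) ∧
      spaceTest s γ₂ δ₂ ψ' = propagator (phase γ₁ γ₂ δ₁ δ₂) t (spaceTest s γ₂ δ₂ ψ) := by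
  have h1 : ContDiff ℝ ∞ fun ξ =>
      Complex.exp (((t * phase γ₁ γ₂ δ₁ δ₂ ξ : ℝ) : ℂ) * Complex.I) * ψ ξ := by
    have := contDiff_phase hγ₁ hδ₁ γ₂ δ₂
    exact ((((Complex.ofRealCLM.contDiff.comp (contDiff_const.mul this))).mul
      contDiff_const).cexp).mul (ψ.smooth _)
  have h2 : HasCompactSupport fun ξ =>
      Complex.exp (((t * phase γ₁ γ₂ δ₁ δ₂ ξ : ℝ) : ℂ) * Complex.I) * ψ ξ := hψ.mul_left
  have e1 : timeTest s γ₁ δ₁ (h2.toSchwartzMap h1) =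
      propagator (phase γ₁ γ₂ δ₁ δ₂) t (timeTest s γ₁ δ₁ ψ) := by
    apply Lp.ext
    filter_upwards [coeFn_timeTest hs γ₁ δ₁ (h2.toSchwartzMap h1), coeFn_timeTest hs γ₁ δ₁ ψ,
      coeFn_propagator (measurable_phase γ₁ γ₂ δ₁ δ₂) t (timeTest s γ₁ δ₁ ψ)] with ξ k1 k2 k3
    rw [k1, k3, k2, HasCompactSupport.toSchwartzMap_toFun]
    ring
  refine ⟨h2.toSchwartzMap h1, e1, ?_⟩
  apply Lp.ext
  filter_upwards [coeFn_spaceTest hs hγ₁ hδ₁ γ₂ δ₂ (h2.toSchwartzMap h1),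
    coeFn_spaceTest hs hγ₁ hδ₁ γ₂ δ₂ ψ,
    coeFn_propagator (measurable_phase γ₁ γ₂ δ₁ δ₂) t (timeTest s γ₁ δ₁ ψ),
    coeFn_propagator (measurable_phase γ₁ γ₂ δ₁ δ₂) t (spaceTest s γ₂ δ₂ ψ)] with ξ k1 k2 k3 k4
  rw [k1, e1, k3, k4, k2]
  ring

theorem mild_of_weak (hs : 0 ≤ s) (hγ₁ : 0 < γ₁) (hδ₁ : 0 < δ₁) (γ₂ δ₂ : ℝ) {T : ℝ}
    {g n : ℝ → L2} (hg : Continuous g) (hn : Continuous n)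
    (h : ∀ ψ : 𝓢(ℝ, ℂ), ∀ t ∈ Set.Icc 0 T,
      HasDerivWithinAt (fun t => pair (timeTest s γ₁ δ₁ ψ) (g t))
        (-(pair (spaceTest s γ₂ δ₂ ψ) (g t) - pair (timeTest s γ₁ δ₁ ψ) (n t))) (Set.Icc 0 T) t) :
    ∀ t ∈ Set.Icc 0 T, HasDerivWithinAt (fun t => propagator (phase γ₁ γ₂ δ₁ δ₂) t (g t))
      (propagator (phase γ₁ γ₂ δ₁ δ₂) t (n t)) (Set.Icc 0 T) t := by
  have hφ := measurable_phase γ₁ γ₂ δ₁ δ₂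
  set φ := phase γ₁ γ₂ δ₁ δ₂ with hφdef
  have hnc : Continuous fun t => propagator φ t (n t) :=
    continuous_propagator_apply hφ continuous_id hn
  -- A derivative in `L²` cannot be checked test by test, but the equivalent integral identity can.
  rw [← eq_add_integral_iff_hasDerivWithinAt hnc]
  intro t ht
  rw [← sub_eq_zero]
  refine eq_zero_of_pair_timeTest_eq_zero hs hγ₁ hδ₁ fun ψ hψ => ?_
  have key : ∀ σ ∈ Set.Icc 0 T, HasDerivWithinAt
      (fun τ => pair (timeTest s γ₁ δ₁ ψ) (propagator φ τ (g τ)))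
      (pair (timeTest s γ₁ δ₁ ψ) (propagator φ σ (n σ))) (Set.Icc 0 T) σ := by
    intro σ hσ
    -- The moving test e^{iτφ}ψ is split as its value at τ = σ plus a remainder vanishing there. The
    -- hypothesis handles the fixed part; the remainder contributes the phase term, which cancels
    -- the linear one.
    obtain ⟨ψ', e1, e2⟩ := exists_propagated_test hs hγ₁ hδ₁ γ₂ δ₂ hψ σ
    rw [← hφdef] at e1 e2
    have d1 := h ψ' σ hσ
    have d2 := hasDerivWithinAt_pair_of_eq_zero
      (((hasDerivAt_propagator_timeTest hs hγ₁ hδ₁ γ₂ δ₂ ψ σ).sub_const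
        (timeTest s γ₁ δ₁ ψ')).hasDerivWithinAt (s := Set.Icc 0 T))
      (by rw [e1, sub_self]) hg.continuousWithinAt
    rw [← hφdef, ← e2] at d2
    have d3 := d2.add d1
    rw [← pair_propagator hφ, ← e1]
    convert! d3 using 1
    · funext τ
      rw [← pair_propagator hφ, Pi.add_apply, map_sub]
      simp
    · ring
  have hc : Continuous fun σ => pair (timeTest s γ₁ δ₁ ψ) (propagator φ σ (n σ)) :=
    (ContinuousLinearMap.continuous _).comp hnc
  have h1 := (eq_add_integral_iff_hasDerivWithinAt hc).2 key t ht
  rw [ContinuousLinearMap.intervalIntegral_comp_comm _ (hnc.intervalIntegrable _ _)] at h1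
  rw [map_sub, map_add, h1, sub_self]

/-- The pairing is unchanged when e^{-iτφ} is put on the test and e^{iτφ} on g. The moving test is
again split at the time of differentiation. -/
theorem weak_of_mild (hs : 0 ≤ s) (hγ₁ : 0 < γ₁) (hδ₁ : 0 < δ₁) (γ₂ δ₂ : ℝ) {T : ℝ}
    {g n : ℝ → L2}
    (h : ∀ t ∈ Set.Icc 0 T, HasDerivWithinAt (fun t => propagator (phase γ₁ γ₂ δ₁ δ₂) t (g t))
      (propagator (phase γ₁ γ₂ δ₁ δ₂) t (n t)) (Set.Icc 0 T) t) (ψ : 𝓢(ℝ, ℂ)) :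
    ∀ t ∈ Set.Icc 0 T, HasDerivWithinAt (fun t => pair (timeTest s γ₁ δ₁ ψ) (g t))
        (-(pair (spaceTest s γ₂ δ₂ ψ) (g t) - pair (timeTest s γ₁ δ₁ ψ) (n t)))
        (Set.Icc 0 T) t := by
  intro t ht
  have hφ := measurable_phase γ₁ γ₂ δ₁ δ₂
  set φ := phase γ₁ γ₂ δ₁ δ₂ with hφdef
  set κ := timeTest s γ₁ δ₁ ψ
  set κ' := spaceTest s γ₂ δ₂ ψ
  have d1 : HasDerivAt (fun t => propagator φ (-t) κ) (-propagator φ (-t) κ') t := by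
    have := (hasDerivAt_propagator_timeTest hs hγ₁ hδ₁ γ₂ δ₂ ψ (-t)).scomp t (hasDerivAt_neg t)
    simpa [Function.comp_def] using this
  have d2 := hasDerivWithinAt_pair_of_eq_zero
    ((d1.sub_const (propagator φ (-t) κ)).hasDerivWithinAt (s := Set.Icc 0 T))
    (sub_self _) (h t ht).continuousWithinAt
  have d3 : HasDerivWithinAt (fun τ => pair (propagator φ (-t) κ) (propagator φ τ (g τ)))
      (pair (propagator φ (-t) κ) (propagator φ t (n t))) (Set.Icc 0 T) t :=
    (((pair (propagator φ (-t) κ)).restrictScalars ℝ).hasFDerivAt).comp_hasDerivWithinAt t (h t ht)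
  have hcancel : ∀ (a : ℝ) (f k : L2),
      pair (propagator φ (-a) k) (propagator φ a f) = pair k f := fun a f k => by
    rw [pair_propagator hφ, propagator_propagator hφ, neg_add_cancel, propagator_zero hφ]
  convert! d2.add d3 using 1
  · funext τ
    rw [Pi.add_apply, map_sub, sub_apply, hcancel]
    ring
  · rw [map_neg, neg_apply, hcancel, hcancel]
    ring

end FifthOrderBBM

end

noncomputable section

namespace FifthOrderBBM

/-! ### The ordinary differential equation in `L²` -/

/-- Picard–Lindelöf that also records that the solution stays in the ball of the iteration; the
growth bound of the theorem comes from this. -/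
theorem exists_hasDerivWithinAt_mem_closedBall {E : Type*} [NormedAddCommGroup E] [NormedSpace ℝ E]
    [CompleteSpace E] {f : ℝ → E → E} {tmin tmax : ℝ} {t₀ : Set.Icc tmin tmax} {x₀ : E}
    {a L K : NNReal} (hf : IsPicardLindelof f t₀ x₀ a 0 L K) :
    ∃ α : ℝ → E, α t₀ = x₀ ∧ (∀ t, α t ∈ Metric.closedBall x₀ a) ∧
      ∀ t ∈ Set.Icc tmin tmax, HasDerivWithinAt α (f t (α t)) (Set.Icc tmin tmax) t := by
  have hx : x₀ ∈ Metric.closedBall x₀ (0 : NNReal) := Metric.mem_closedBall_self le_rfl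
  obtain ⟨α, hα⟩ := ODE.FunSpace.exists_isFixedPt_next hf hx
  refine ⟨α.compProj, by rw [ODE.FunSpace.compProj_val, ← hα, ODE.FunSpace.next_apply₀],
    fun t => α.compProj_mem_closedBall hf.mul_max_le, fun t ht => ?_⟩
  apply ODE.hasDerivWithinAt_picard_Icc t₀.2 hf.continuousOn_uncurry
    α.continuous_compProj.continuousOn (fun _ _ => α.compProj_mem_closedBall hf.mul_max_le)
    x₀ ht |>.congr_of_mem _ ht
  intro t' ht'
  nth_rw 1 [← hα]
  rw [ODE.FunSpace.compProj_of_mem ht', ODE.FunSpace.next_apply]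

/-- The nonlinearity `N`, seen through the linear flow. -/
def field (φ : ℝ → ℝ) (N : L2 → L2) (t : ℝ) (v : L2) : L2 :=
  propagator φ t (N (propagator φ (-t) v))

/-- `v` solves `v' = field φ N t v` on `[0,T]`. -/
def IsFlow (φ : ℝ → ℝ) (N : L2 → L2) (T : ℝ) (v : ℝ → L2) : Prop :=
  ∀ t ∈ Set.Icc 0 T, HasDerivWithinAt v (field φ N t (v t)) (Set.Icc 0 T) t

variable {φ : ℝ → ℝ} {N : L2 → L2}

theorem lipschitzOnWith_field (hφ : Measurable φ) {R : ℝ} {K : NNReal}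
    (hN : LipschitzOnWith K N (Metric.closedBall 0 R)) (t : ℝ) :
    LipschitzOnWith K (field φ N t) (Metric.closedBall 0 R) := by
  refine LipschitzOnWith.of_dist_le_mul fun x hx y hy => ?_
  have h := hN.dist_le_mul (propagator φ (-t) x)
    (by rwa [mem_closedBall_zero_iff, norm_propagator hφ, ← mem_closedBall_zero_iff])
    (propagator φ (-t) y)
    (by rwa [mem_closedBall_zero_iff, norm_propagator hφ, ← mem_closedBall_zero_iff])
  rw [dist_eq_norm (propagator φ (-t) x), ← map_sub, norm_propagator hφ, ← dist_eq_norm] at h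
  rwa [field, field, dist_eq_norm (propagator φ t _), ← map_sub, norm_propagator hφ,
    ← dist_eq_norm]

theorem continuous_of_lipschitzOnWith_closedBall
    (hN : ∀ R : ℝ, ∃ K : NNReal, LipschitzOnWith K N (Metric.closedBall 0 R)) : Continuous N := by
  rw [continuous_iff_continuousAt]
  intro x
  obtain ⟨K, hK⟩ := hN (‖x‖ + 1)
  refine hK.continuousOn.continuousAt (Filter.mem_of_superset
    (Metric.ball_mem_nhds x one_pos) fun y hy => ?_)
  rw [mem_closedBall_zero_iff]
  rw [Metric.mem_ball, dist_eq_norm] at hy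
  linarith [norm_le_norm_add_norm_sub' y x]

theorem norm_field_le {C : ℝ} (hφ : Measurable φ) (hC : 0 < C)
    (hN : ∀ f, ‖N f‖ ≤ C * ‖f‖ ^ 2 * (1 + ‖f‖)) {M : ℝ} (_hM : 0 ≤ M) (t : ℝ) {v : L2}
    (hv : ‖v‖ ≤ 2 * M) : ‖field φ N t v‖ ≤ 8 * C * M ^ 2 * (1 + M) := by
  rw [field, norm_propagator hφ]
  refine (hN _).trans ?_
  rw [norm_propagator hφ]
  calc C * ‖v‖ ^ 2 * (1 + ‖v‖) ≤ C * (2 * M) ^ 2 * (1 + 2 * M) := by gcongr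
    _ ≤ _ := by
      have : 0 ≤ C * M ^ 2 := by positivity
      nlinarith

theorem exists_isFlow {C : ℝ} (hφ : Measurable φ) (hC : 0 < C)
    (hN : ∀ f, ‖N f‖ ≤ C * ‖f‖ ^ 2 * (1 + ‖f‖))
    (hL : ∀ R : ℝ, ∃ K : NNReal, LipschitzOnWith K N (Metric.closedBall 0 R))
    {T : ℝ} (hT : 0 < T) (v₀ : L2) (h : 8 * C * ‖v₀‖ * (1 + ‖v₀‖) * T ≤ 1) :
    ∃ v, v 0 = v₀ ∧ (∀ t, ‖v t‖ ≤ 2 * ‖v₀‖) ∧ IsFlow φ N T v := by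
  obtain ⟨K, hK⟩ := hL (2 * ‖v₀‖)
  have hball : ∀ x ∈ Metric.closedBall v₀ ‖v₀‖, ‖x‖ ≤ 2 * ‖v₀‖ := fun x hx => by
    rw [Metric.mem_closedBall, dist_eq_norm] at hx
    linarith [norm_le_norm_add_norm_sub' x v₀]
  -- The ball of radius ‖v₀‖ about v₀ lies in the ball of radius 2‖v₀‖ about 0. The smallness
  -- condition on T says precisely that speed times time does not exceed the radius.
  have hPL : IsPicardLindelof (field φ N) (⟨0, Set.left_mem_Icc.2 hT.le⟩ : Set.Icc (0 : ℝ) T) v₀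
      ‖v₀‖₊ 0 (8 * C * ‖v₀‖ ^ 2 * (1 + ‖v₀‖)).toNNReal K := by
    refine ⟨fun t _ => ?_, fun x _ => ?_, fun t _ x hx => ?_, ?_⟩
    · exact (lipschitzOnWith_field hφ hK t).mono fun x hx => by
        rw [mem_closedBall_zero_iff]
        exact hball x hx
    · exact (continuous_propagator_apply hφ continuous_id
        ((continuous_of_lipschitzOnWith_closedBall hL).comp
          ((continuous_propagator hφ x).comp continuous_neg))).continuousOn
    · rw [Real.coe_toNNReal _ (by positivity)]
      exact norm_field_le hφ hC hN (norm_nonneg _) t (hball x hx)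
    · rw [Real.coe_toNNReal _ (by positivity)]
      simp only [sub_zero, sub_self, coe_nnnorm, NNReal.coe_zero, max_eq_left hT.le]
      calc 8 * C * ‖v₀‖ ^ 2 * (1 + ‖v₀‖) * T = ‖v₀‖ * (8 * C * ‖v₀‖ * (1 + ‖v₀‖) * T) := by ring
        _ ≤ ‖v₀‖ := mul_le_of_le_one_right (norm_nonneg _) h
  obtain ⟨v, h1, h2, h3⟩ := exists_hasDerivWithinAt_mem_closedBall hPL
  exact ⟨v, h1, fun t => hball _ (h2 t), h3⟩

theorem IsFlow.continuousOn {T : ℝ} {v : ℝ → L2} (hv : IsFlow φ N T v) :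
    ContinuousOn v (Set.Icc 0 T) := fun t ht => (hv t ht).continuousWithinAt

theorem IsFlow.dist_le {T R : ℝ} {K : NNReal} {v w : ℝ → L2} (hφ : Measurable φ)
    (hN : LipschitzOnWith K N (Metric.closedBall 0 R)) (hv : IsFlow φ N T v)
    (hw : IsFlow φ N T w) (hvR : ∀ t ∈ Set.Icc 0 T, ‖v t‖ ≤ R)
    (hwR : ∀ t ∈ Set.Icc 0 T, ‖w t‖ ≤ R) :
    ∀ t ∈ Set.Icc 0 T, dist (v t) (w t) ≤ dist (v 0) (w 0) * Real.exp (K * T) := by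
  intro t ht
  have hright : ∀ {u : ℝ → L2}, IsFlow φ N T u → ∀ t ∈ Set.Ico 0 T,
      HasDerivWithinAt u (field φ N t (u t)) (Set.Ici t) t := fun hu t ht =>
    (hu t ⟨ht.1, ht.2.le⟩).mono_of_mem_nhdsWithin
      (Filter.mem_of_superset (Icc_mem_nhdsGE ht.2) (Set.Icc_subset_Icc_left ht.1))
  have h := dist_le_of_trajectories_ODE_of_mem (v := field φ N)
    (s := fun _ => Metric.closedBall 0 R) (fun t _ => lipschitzOnWith_field hφ hN t)
    hv.continuousOn (hright hv)
    (fun t ht => mem_closedBall_zero_iff.2 (hvR t ⟨ht.1, ht.2.le⟩))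
    hw.continuousOn (hright hw)
    (fun t ht => mem_closedBall_zero_iff.2 (hwR t ⟨ht.1, ht.2.le⟩)) le_rfl t ht
  refine h.trans ?_
  gcongr
  linarith [ht.2]

/-- Uniqueness needs no size restriction: two curves continuous on a compact interval lie in a
common ball, where Grönwall applies with that ball's Lipschitz constant. -/
theorem IsFlow.eqOn {T : ℝ} {v w : ℝ → L2} (hφ : Measurable φ)
    (hL : ∀ R : ℝ, ∃ K : NNReal, LipschitzOnWith K N (Metric.closedBall 0 R))
    (hv : IsFlow φ N T v) (hw : IsFlow φ N T w) (h0 : v 0 = w 0) :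
    Set.EqOn v w (Set.Icc 0 T) := by
  obtain ⟨R₁, h1⟩ := isCompact_Icc.exists_bound_of_continuousOn hv.continuousOn
  obtain ⟨R₂, h2⟩ := isCompact_Icc.exists_bound_of_continuousOn hw.continuousOn
  obtain ⟨K, hK⟩ := hL (max R₁ R₂)
  intro t ht
  have := hv.dist_le hφ hK hw (fun t ht => (h1 t ht).trans (le_max_left _ _))
    (fun t ht => (h2 t ht).trans (le_max_right _ _)) t ht
  rw [h0, dist_self, zero_mul] at this
  exact dist_le_zero.1 this

/-! ### Bounds for the nonlinearity -/

variable {s γ₁ δ₁ : ℝ}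

theorem norm_bilin_diag_sub_le {E F : Type*} [NormedAddCommGroup E] [NormedSpace ℂ E]
    [NormedAddCommGroup F] [NormedSpace ℂ F] (B : E →L[ℂ] E →L[ℂ] F) (f g : E) :
    ‖B f f - B g g‖ ≤ ‖B‖ * (‖f‖ + ‖g‖) * ‖f - g‖ := by
  have e : B f f - B g g = B (f - g) f + B g (f - g) := by
    simp only [map_sub, sub_apply]
    abel
  rw [e]
  refine (norm_add_le _ _).trans ?_
  have h1 := B.le_opNorm₂ (f - g) f
  have h2 := B.le_opNorm₂ g (f - g)
  linarith

theorem norm_bilin_add_bilin_add_trilin_le {E F : Type*} [NormedAddCommGroup E] [NormedSpace ℂ E]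
    [NormedAddCommGroup F] [NormedSpace ℂ F] (Bq Br : E →L[ℂ] E →L[ℂ] F) (Bi : E →L[ℂ] E →L[ℂ] E)
    (Bo : E →L[ℂ] E →L[ℂ] F) (f : E) :
    ‖Bq f f + Br f f + Bo f (Bi f f)‖ ≤
      (‖Bq‖ + ‖Br‖ + ‖Bo‖ * ‖Bi‖ + 1) * ‖f‖ ^ 2 * (1 + ‖f‖) := by
  have h1 := Bq.le_opNorm₂ f f
  have h2 := Br.le_opNorm₂ f f
  have h3 := Bo.le_opNorm₂ f (Bi f f)
  have h4 := mul_le_mul_of_nonneg_left (Bi.le_opNorm₂ f f)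
    (by positivity : 0 ≤ ‖Bo‖ * ‖f‖)
  refine norm_add₃_le.trans ((add_le_add (add_le_add h1 h2) (h3.trans h4)).trans ?_)
  -- This is the claimed bound minus the sum of the three estimates. The summand 1 in the constant
  -- serves to make it strictly positive.
  have k : 0 ≤ (‖Bq‖ + ‖Br‖) * ‖f‖ ^ 3 + ‖Bo‖ * ‖Bi‖ * ‖f‖ ^ 2 + ‖f‖ ^ 2 * (1 + ‖f‖) := by
    positivity
  refine le_of_sub_nonneg (k.trans_eq ?_)
  ring

theorem exists_norm_nonlinearity_le (γ : ℝ) (hs : 1 ≤ s) (hγ₁ : 0 < γ₁) (hδ₁ : 0 < δ₁) :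
    ∃ C : ℝ, 0 < C ∧ ∀ f, ‖nonlinearity γ hs hγ₁ hδ₁ f‖ ≤ C * ‖f‖ ^ 2 * (1 + ‖f‖) :=
  ⟨_, by positivity, fun f => norm_bilin_add_bilin_add_trilin_le
    (isBilinKernel_quadratic hs hγ₁ hδ₁ (-(3 / 4)) (-γ)).bilin
    (isBilinKernel_deriv hs hγ₁ hδ₁ (7 / 48)).bilin (isBilinKernel_square hs).bilin
    (isBilinKernel_cubic hs hγ₁ hδ₁ (1 / 8) 0).bilin f⟩

theorem exists_lipschitzOnWith_nonlinearity (γ : ℝ) (hs : 1 ≤ s) (hγ₁ : 0 < γ₁) (hδ₁ : 0 < δ₁)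
    (R : ℝ) :
    ∃ K : NNReal, LipschitzOnWith K (nonlinearity γ hs hγ₁ hδ₁) (Metric.closedBall 0 R) := by
  set Bq := (isBilinKernel_quadratic hs hγ₁ hδ₁ (-(3 / 4)) (-γ)).bilin
  set Br := (isBilinKernel_deriv hs hγ₁ hδ₁ (7 / 48)).bilin
  set Bo := (isBilinKernel_cubic hs hγ₁ hδ₁ (1 / 8) 0).bilin
  set Bi := (isBilinKernel_square hs).bilin
  refine ⟨((‖Bq‖ + ‖Br‖) * (2 * R) + 3 * (‖Bo‖ * ‖Bi‖) * R ^ 2).toNNReal,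
    LipschitzOnWith.of_dist_le_mul fun f hf g hg => ?_⟩
  rw [mem_closedBall_zero_iff] at hf hg
  have hR : 0 ≤ R := (norm_nonneg _).trans hf
  rw [Real.coe_toNNReal _ (by positivity), dist_eq_norm, dist_eq_norm]
  have h1 := norm_bilin_diag_sub_le Bq f g
  have h2 := norm_bilin_diag_sub_le Br f g
  have h3 : ‖Bo f (Bi f f) - Bo g (Bi g g)‖ ≤ 3 * (‖Bo‖ * ‖Bi‖) * R ^ 2 * ‖f - g‖ := by
    have e : Bo f (Bi f f) - Bo g (Bi g g) = Bo (f - g) (Bi f f) + Bo g (Bi f f - Bi g g) := by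
      simp only [map_sub, sub_apply]
      abel
    have k1 : ‖Bo (f - g) (Bi f f)‖ ≤ ‖Bo‖ * ‖f - g‖ * (‖Bi‖ * R * R) := by
      refine (Bo.le_opNorm₂ _ _).trans ?_
      gcongr
      refine (Bi.le_opNorm₂ _ _).trans ?_
      gcongr
    have k2 : ‖Bo g (Bi f f - Bi g g)‖ ≤ ‖Bo‖ * R * (‖Bi‖ * (R + R) * ‖f - g‖) := by
      refine (Bo.le_opNorm₂ _ _).trans ?_
      gcongr
      refine (norm_bilin_diag_sub_le Bi f g).trans ?_
      gcongr
    rw [e]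
    refine (norm_add_le _ _).trans ((add_le_add k1 k2).trans (le_of_eq ?_))
    ring
  have h1' : ‖Bq f f - Bq g g‖ ≤ ‖Bq‖ * (R + R) * ‖f - g‖ := h1.trans (by gcongr)
  have h2' : ‖Br f f - Br g g‖ ≤ ‖Br‖ * (R + R) * ‖f - g‖ := h2.trans (by gcongr)
  calc ‖nonlinearity γ hs hγ₁ hδ₁ f - nonlinearity γ hs hγ₁ hδ₁ g‖
      = ‖(Bq f f - Bq g g) + (Br f f - Br g g) + (Bo f (Bi f f) - Bo g (Bi g g))‖ := by
        congr 1
        change (Bq f f + Br f f + Bo f (Bi f f)) - (Bq g g + Br g g + Bo g (Bi g g)) = _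
        abel
    _ ≤ ‖Bq f f - Bq g g‖ + ‖Br f f - Br g g‖ + ‖Bo f (Bi f f) - Bo g (Bi g g)‖ := norm_add₃_le
    _ ≤ ‖Bq‖ * (R + R) * ‖f - g‖ + ‖Br‖ * (R + R) * ‖f - g‖ +
        3 * (‖Bo‖ * ‖Bi‖) * R ^ 2 * ‖f - g‖ := by gcongr
    _ = _ := by ring

theorem continuous_nonlinearity (γ : ℝ) (hs : 1 ≤ s) (hγ₁ : 0 < γ₁) (hδ₁ : 0 < δ₁) :
    Continuous (nonlinearity γ hs hγ₁ hδ₁) :=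
  continuous_of_lipschitzOnWith_closedBall (exists_lipschitzOnWith_nonlinearity γ hs hγ₁ hδ₁)

/-! ### Solutions of the initial value problem as integral curves -/

/-- The curve in `L²` that corresponds to a curve in `H^s`: its Fourier side, seen through the
linear flow. -/
def profile (φ : ℝ → ℝ) {T : ℝ} (hT : 0 < T) (η : C(Set.Icc (0 : ℝ) T, Hs s)) (t : ℝ) : L2 :=
  propagator φ t (Hs.hat s (Set.IccExtend hT.le η t))

theorem profile_coe (hφ : Measurable φ) {T : ℝ} (hT : 0 < T) (η : C(Set.Icc (0 : ℝ) T, Hs s))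
    (t : Set.Icc (0 : ℝ) T) : Hs.hat s (η t) = propagator φ (-t) (profile φ hT η t) := by
  rw [profile, propagator_propagator hφ, neg_add_cancel, propagator_zero hφ, Set.IccExtend_val]

theorem norm_profile (hφ : Measurable φ) {T : ℝ} (hT : 0 < T) (η : C(Set.Icc (0 : ℝ) T, Hs s))
    (t : Set.Icc (0 : ℝ) T) : ‖profile φ hT η t‖ = ‖η t‖ := by
  rw [← (Hs.hat s).norm_map (η t), profile_coe hφ hT, norm_propagator hφ]

theorem profile_zero (hφ : Measurable φ) {T : ℝ} (hT : 0 < T) (η : C(Set.Icc (0 : ℝ) T, Hs s)) :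
    profile φ hT η 0 = Hs.hat s (η ⟨0, Set.left_mem_Icc.2 hT.le⟩) := by
  rw [profile_coe hφ hT]
  simp [hφ]

theorem ext_of_eqOn_profile (hφ : Measurable φ) {T : ℝ} (hT : 0 < T)
    {η ζ : C(Set.Icc (0 : ℝ) T, Hs s)}
    (h : Set.EqOn (profile φ hT η) (profile φ hT ζ) (Set.Icc 0 T)) : η = ζ := by
  ext t
  apply (Hs.hat s).injective
  rw [profile_coe hφ hT, profile_coe hφ hT, h t.2]

theorem exists_profile_eq (hφ : Measurable φ) {T : ℝ} (hT : 0 < T) {v : ℝ → L2}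
    (hv : ContinuousOn v (Set.Icc 0 T)) :
    ∃ η : C(Set.Icc (0 : ℝ) T, Hs s), Set.EqOn (profile φ hT η) v (Set.Icc 0 T) := by
  have hc : Continuous fun t : Set.Icc (0 : ℝ) T => propagator φ (-t) (v t) :=
    continuous_propagator_apply hφ continuous_subtype_val.neg hv.domRestrict
  refine ⟨⟨fun t => (Hs.hat s).symm (propagator φ (-t) (v t)),
    (Hs.hat s).symm.continuous.comp hc⟩, fun t ht => ?_⟩
  rw [profile, Set.IccExtend_of_mem _ _ ht]
  simp [propagator_propagator hφ, hφ]

theorem isSolution_iff (γ γ₂ δ₂ : ℝ) (hs : 1 ≤ s) (hγ₁ : 0 < γ₁) (hδ₁ : 0 < δ₁) {T : ℝ}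
    (hT : 0 < T) (η₀ : Hs s) (η : C(Set.Icc (0 : ℝ) T, Hs s)) :
    IsSolution γ₁ γ₂ δ₁ δ₂ γ hT η₀ η ↔ η ⟨0, Set.left_mem_Icc.2 hT.le⟩ = η₀ ∧
      IsFlow (phase γ₁ γ₂ δ₁ δ₂) (nonlinearity γ hs hγ₁ hδ₁) T
        (profile (phase γ₁ γ₂ δ₁ δ₂) hT η) := by
  have hs0 : 0 ≤ s := by linarith
  have hφ := measurable_phase γ₁ γ₂ δ₁ δ₂
  set g : ℝ → L2 := fun t => Hs.hat s (Set.IccExtend hT.le η t) with hg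
  have hgc : Continuous g := (Hs.hat s).continuous.comp η.continuous.Icc_extend'
  have hnc : Continuous fun t => nonlinearity γ hs hγ₁ hδ₁ (g t) :=
    (continuous_nonlinearity γ hs hγ₁ hδ₁).comp hgc
  have hA : ∀ ψ : 𝓢(ℝ, ℂ), Continuous fun t => pair (timeTest s γ₁ δ₁ ψ) (g t) := fun ψ =>
    (ContinuousLinearMap.continuous _).comp hgc
  have hB : ∀ ψ : 𝓢(ℝ, ℂ), Continuous fun t => pair (spaceTest s γ₂ δ₂ ψ) (g t) -
      pair (timeTest s γ₁ δ₁ ψ) (nonlinearity γ hs hγ₁ hδ₁ (g t)) := fun ψ =>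
    ((ContinuousLinearMap.continuous _).comp hgc).sub
      ((ContinuousLinearMap.continuous _).comp hnc)
  have hfield : ∀ t, field (phase γ₁ γ₂ δ₁ δ₂) (nonlinearity γ hs hγ₁ hδ₁) t
      (profile (phase γ₁ γ₂ δ₁ δ₂) hT η t) =
      propagator (phase γ₁ γ₂ δ₁ δ₂) t (nonlinearity γ hs hγ₁ hδ₁ (g t)) := fun t => by
    rw [field, profile, propagator_propagator hφ, neg_add_cancel, propagator_zero hφ]
  constructor
  · rintro ⟨h0, h⟩
    refine ⟨h0, fun t ht => ?_⟩
    rw [hfield]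
    refine mild_of_weak hs0 hγ₁ hδ₁ γ₂ δ₂ hgc hnc (fun ψ => ?_) t ht
    refine (eq_add_integral_iff_hasDerivWithinAt (hB ψ).neg).1
      ((weak_deriv_iff hT (hA ψ) (hB ψ)).1 fun χ h1 h2 h3 => ?_)
    have := h χ h1 h2 h3 (FourierTransform.fourier ψ)
    simp only [timeTerm_apply_fourier hs0, spaceTerm_apply_fourier γ γ₂ δ₂ hs hγ₁ hδ₁] at this
    exact this
  · rintro ⟨h0, h⟩
    refine ⟨h0, fun χ h1 h2 h3 φ => ?_⟩
    obtain ⟨ψ, rfl⟩ : ∃ ψ : 𝓢(ℝ, ℂ), φ = FourierTransform.fourier ψ :=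
      ⟨FourierTransformInv.fourierInv φ, (FourierTransform.fourier_fourierInv_eq φ).symm⟩
    simp only [timeTerm_apply_fourier hs0, spaceTerm_apply_fourier γ γ₂ δ₂ hs hγ₁ hδ₁]
    refine (weak_deriv_iff hT (hA ψ) (hB ψ)).2 ?_ χ h1 h2 h3
    refine (eq_add_integral_iff_hasDerivWithinAt (hB ψ).neg).2 ?_
    refine weak_of_mild hs0 hγ₁ hδ₁ γ₂ δ₂ (g := g)
      (n := fun t => nonlinearity γ hs hγ₁ hδ₁ (g t)) (fun t ht => ?_) ψ
    have := h t ht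
    rw [hfield] at this
    exact this

end FifthOrderBBM

end

noncomputable section

namespace FifthOrderBBM

open FourierTransform ComplexConjugate

/-! ### Real-valued solutions -/

/-- Complex conjugation on `L²`. -/
def conjL2 : L2 →L[ℝ] L2 := ContinuousLinearMap.compLpL 2 volume (Complex.conjCLE : ℂ →L[ℝ] ℂ)

/-- The operator on `L²` that corresponds to complex conjugation on the Fourier side. -/
def conjNeg : L2 →L[ℝ] L2 :=
  (Lp.compMeasurePreservingₗᵢ ℝ Neg.neg
    (Measure.measurePreserving_neg (volume : Measure ℝ))).toContinuousLinearMap ∘L conjL2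

theorem coeFn_conjL2 (f : L2) : conjL2 f =ᵐ[volume] fun x => conj (f x) :=
  ContinuousLinearMap.coeFn_compLpL _ f

theorem ae_neg {p : ℝ → Prop} (h : ∀ᵐ x, p x) : ∀ᵐ x, p (-x) :=
  (Measure.measurePreserving_neg (volume : Measure ℝ)).quasiMeasurePreserving.ae h

theorem coeFn_conjNeg (f : L2) : conjNeg f =ᵐ[volume] fun ξ => conj (f (-ξ)) := by
  refine (Lp.coeFn_compMeasurePreserving (conjL2 f)
    (Measure.measurePreserving_neg (volume : Measure ℝ))).trans ?_
  exact ae_neg (coeFn_conjL2 f)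

theorem conjNeg_mulOp {m : ℝ → ℂ} (hm : MemLp m ∞ volume) (h : ∀ ξ, conj (m (-ξ)) = m ξ)
    (f : L2) : conjNeg (mulOp m f) = mulOp m (conjNeg f) := by
  apply Lp.ext
  filter_upwards [coeFn_conjNeg (mulOp m f), ae_neg (coeFn_mulOp hm f), coeFn_mulOp hm (conjNeg f),
    coeFn_conjNeg f] with ξ h1 h2 h3 h4
  rw [h1, h2, h3, h4, map_mul, h]

theorem conjNeg_propagator {φ : ℝ → ℝ} (hφ : Measurable φ) (hodd : ∀ ξ, φ (-ξ) = -φ ξ) (t : ℝ)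
    (f : L2) : conjNeg (propagator φ t f) = propagator φ t (conjNeg f) := by
  refine conjNeg_mulOp (memLp_exp hφ t) (fun ξ => ?_) f
  rw [← Complex.exp_conj, map_mul, Complex.conj_I, Complex.conj_ofReal, hodd]
  congr 1
  push_cast
  ring

/-- The substitution ζ ↦ -ζ in the integral. -/
theorem conjNeg_bilin {k : ℝ → ℝ → ℂ} (hk : IsBilinKernel k)
    (h : ∀ ξ ζ, conj (k (-ξ) (-ζ)) = k ξ ζ) (f g : L2) :
    conjNeg (hk.bilin f g) = hk.bilin (conjNeg f) (conjNeg g) := by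
  apply Lp.ext
  filter_upwards [coeFn_conjNeg (hk.bilin f g), ae_neg (hk.coeFn_bilin f g),
    hk.coeFn_bilin (conjNeg f) (conjNeg g)] with ξ h1 h2 h3
  rw [h1, h2, h3, ← integral_conj, ← integral_neg_eq_self]
  refine integral_congr_ae ?_
  filter_upwards [coeFn_conjNeg f, IsBilinKernel.ae_sub_left (coeFn_conjNeg g) ξ] with ζ h4 h5
  rw [h4, h5, map_mul, map_mul, h]
  congr 4
  ring

theorem fourier_conjL2 (f : L2) : 𝓕 (conjL2 f) = conjNeg (𝓕 f) := by
  have hF : Continuous fun F : L2 => (𝓕 F : L2) := continuous_fourier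
  refine denseRange_schwartzL2.induction_on (p := fun f => (𝓕 (conjL2 f) : L2) = conjNeg (𝓕 f)) f
    (isClosed_eq (hF.comp conjL2.continuous) (conjNeg.continuous.comp hF)) fun ψ => ?_
  have h : conjL2 (schwartzL2 ψ) =
      schwartzL2 (SchwartzMap.postcompCLM (𝕜 := ℝ) (Complex.conjCLE : ℂ →L[ℝ] ℂ) ψ) := by
    apply Lp.ext
    filter_upwards [coeFn_conjL2 (schwartzL2 ψ), coeFn_schwartzL2 ψ, coeFn_schwartzL2
      (SchwartzMap.postcompCLM (𝕜 := ℝ) (Complex.conjCLE : ℂ →L[ℝ] ℂ) ψ)] with x h1 h2 h3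
    rw [h1, h2, h3]
    rfl
  rw [h, SchwartzMap.toLp_fourier_eq, SchwartzMap.toLp_fourier_eq]
  apply Lp.ext
  filter_upwards [coeFn_conjNeg (schwartzL2 (𝓕 ψ)), ae_neg (coeFn_schwartzL2 (𝓕 ψ)),
    coeFn_schwartzL2 (𝓕 (SchwartzMap.postcompCLM (𝕜 := ℝ) (Complex.conjCLE : ℂ →L[ℝ] ℂ) ψ))]
    with ξ h1 h2 h3
  rw [h1, h2, h3, SchwartzMap.fourier_coe, SchwartzMap.fourier_coe, Real.fourier_eq',
    Real.fourier_eq', ← integral_conj]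
  refine integral_congr_ae (Filter.Eventually.of_forall fun x => ?_)
  simp only [smul_eq_mul, map_mul, ← Complex.exp_conj, Complex.conj_I, Complex.conj_ofReal]
  refine congr (congrArg _ (congrArg _ ?_)) rfl
  simp

variable {s γ₁ δ₁ : ℝ}

theorem conj_cbracket_neg (a ξ : ℝ) : conj (cbracket a (-ξ)) = cbracket a ξ := by
  rw [cbracket, cbracket, bracket_even, Complex.conj_ofReal]

theorem conj_symX_neg (ξ : ℝ) : conj (symX (-ξ)) = symX ξ := by
  rw [symX, symX, map_mul, Complex.conj_I, Complex.conj_ofReal]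
  push_cast
  ring

theorem conj_derivSymbol_neg (ξ : ℝ) : conj (derivSymbol s (-ξ)) = derivSymbol s ξ := by
  rw [derivSymbol, derivSymbol, map_mul, conj_symX_neg, conj_cbracket_neg]

theorem elliptic_neg (ξ : ℝ) : elliptic γ₁ δ₁ (-ξ) = elliptic γ₁ δ₁ ξ := by
  unfold elliptic
  ring

theorem phase_neg (γ₂ δ₂ ξ : ℝ) : phase γ₁ γ₂ δ₁ δ₂ (-ξ) = -phase γ₁ γ₂ δ₁ δ₂ ξ := by
  rw [phase, phase, elliptic_neg, ← neg_div]
  ring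

theorem conj_outerSymbol_neg {c₁ c₂ : ℂ} (h₁ : conj c₁ = c₁) (h₂ : conj c₂ = c₂) (ξ : ℝ) :
    conj (outerSymbol s γ₁ δ₁ c₁ c₂ (-ξ)) = outerSymbol s γ₁ δ₁ c₁ c₂ ξ := by
  rw [outerSymbol, outerSymbol, map_mul, Complex.conj_ofReal, map_add, map_mul, map_mul, map_pow,
    conj_symX_neg, h₁, h₂, elliptic_neg, bracket_even]

theorem conj_kernel_neg {m p q : ℝ → ℂ} (hm : ∀ ξ, conj (m (-ξ)) = m ξ)
    (hp : ∀ ξ, conj (p (-ξ)) = p ξ) (hq : ∀ ξ, conj (q (-ξ)) = q ξ) (ξ ζ : ℝ) :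
    conj (m (-ξ) * (p (-ζ) * q (-ξ - -ζ))) = m ξ * (p ζ * q (ξ - ζ)) := by
  rw [map_mul, map_mul, hm, hp, neg_sub_neg, ← neg_sub ξ ζ, hq]

theorem conjNeg_nonlinearity (γ : ℝ) (hs : 1 ≤ s) (hγ₁ : 0 < γ₁) (hδ₁ : 0 < δ₁) (f : L2) :
    conjNeg (nonlinearity γ hs hγ₁ hδ₁ f) = nonlinearity γ hs hγ₁ hδ₁ (conjNeg f) := by
  have hb := fun a => conj_cbracket_neg a
  rw [nonlinearity, nonlinearity, map_add, map_add,
    conjNeg_bilin _ (conj_kernel_neg (conj_outerSymbol_neg (Complex.conj_eq_iff_im.2 (by norm_num))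
      (Complex.conj_eq_iff_im.2 (by norm_num))) (hb _) (hb _)),
    conjNeg_bilin _ (conj_kernel_neg (conj_outerSymbol_neg (Complex.conj_eq_iff_im.2 (by norm_num))
      (Complex.conj_eq_iff_im.2 (by norm_num)))
      conj_derivSymbol_neg conj_derivSymbol_neg),
    conjNeg_bilin _ (conj_kernel_neg (conj_outerSymbol_neg (Complex.conj_eq_iff_im.2 (by norm_num))
      (Complex.conj_eq_iff_im.2 (by norm_num))) (hb _) (hb _)),
    conjNeg_bilin _ (conj_kernel_neg (hb _) (hb _) (hb _))]

/-- `conjNeg` is real-linear and continuous, so it passes through the time derivative; oddness of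
the phase lets it pass through the propagator. -/
theorem IsFlow.conjNeg_comp {φ : ℝ → ℝ} {N : L2 → L2} {T : ℝ} {v : ℝ → L2} (hφ : Measurable φ)
    (hodd : ∀ ξ, φ (-ξ) = -φ ξ) (hN : ∀ f, conjNeg (N f) = N (conjNeg f)) (hv : IsFlow φ N T v) :
    IsFlow φ N T fun t => conjNeg (v t) := by
  intro t ht
  have h := conjNeg.hasFDerivAt.comp_hasDerivWithinAt t (hv t ht)
  rwa [field, conjNeg_propagator hφ hodd, hN, conjNeg_propagator hφ hodd] at h

theorem mulOp_cbracket_injective (hs : 0 ≤ s) :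
    Function.Injective (mulOp (cbracket (-s))) := by
  intro f g h
  have hm : MemLp (cbracket (-s)) ∞ volume := memLp_cbracket (by linarith)
  apply Lp.ext
  filter_upwards [coeFn_mulOp hm f, coeFn_mulOp hm g] with ξ h1 h2
  rw [h, h2] at h1
  have : cbracket (-s) ξ ≠ 0 := Complex.ofReal_ne_zero.2 (bracket_pos _ _).ne'
  exact (mul_left_cancel₀ this h1).symm

theorem isReal_iff (hs : 0 ≤ s) (u : Hs s) :
    IsReal u ↔ conjNeg (Hs.hat s u) = Hs.hat s u := by
  have hm : MemLp (cbracket (-s)) ∞ volume := memLp_cbracket (by linarith)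
  have h1 : IsReal u ↔ conjL2 (funOf u) = funOf u := by
    rw [IsReal, l2Fun_toDist hs, Lp.ext_iff]
    refine Filter.eventually_congr ?_
    filter_upwards [coeFn_conjL2 (funOf u)] with x hx
    rw [hx, Complex.conj_eq_iff_im]
  have hinj : Function.Injective (𝓕 : L2 → L2) := fun f g h => by
    rw [← fourierInv_fourier_eq (F := L2) f, h, fourierInv_fourier_eq]
  rw [h1, ← hinj.eq_iff, fourier_conjL2, funOf, fourier_fourierInv_eq,
    conjNeg_mulOp hm (conj_cbracket_neg _), (mulOp_cbracket_injective hs).eq_iff]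

end FifthOrderBBM

end

noncomputable section

namespace FifthOrderBBM

/-! ### The initial value problem -/

variable {s γ₁ δ₁ : ℝ} {γ γ₂ δ₂ T : ℝ}

theorem IsSolution.eq (hs : 1 ≤ s) (hγ₁ : 0 < γ₁) (hδ₁ : 0 < δ₁) {hT : 0 < T} {η₀ : Hs s}
    {η ζ : C(Set.Icc (0 : ℝ) T, Hs s)} (hη : IsSolution γ₁ γ₂ δ₁ δ₂ γ hT η₀ η)
    (hζ : IsSolution γ₁ γ₂ δ₁ δ₂ γ hT η₀ ζ) : η = ζ := by
  have hφ := measurable_phase γ₁ γ₂ δ₁ δ₂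
  obtain ⟨h0, h⟩ := (isSolution_iff γ γ₂ δ₂ hs hγ₁ hδ₁ hT η₀ η).1 hη
  obtain ⟨k0, k⟩ := (isSolution_iff γ γ₂ δ₂ hs hγ₁ hδ₁ hT η₀ ζ).1 hζ
  refine ext_of_eqOn_profile hφ hT
    (h.eqOn hφ (exists_lipschitzOnWith_nonlinearity γ hs hγ₁ hδ₁) k ?_)
  rw [profile_zero hφ, profile_zero hφ, h0, k0]

theorem exists_isSolution {C : ℝ} (hC : 0 < C) (hs : 1 ≤ s) (hγ₁ : 0 < γ₁) (hδ₁ : 0 < δ₁)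
    (hN : ∀ f, ‖nonlinearity γ hs hγ₁ hδ₁ f‖ ≤ C * ‖f‖ ^ 2 * (1 + ‖f‖)) (γ₂ δ₂ : ℝ) (hT : 0 < T)
    (η₀ : Hs s) (h : 8 * C * ‖η₀‖ * (1 + ‖η₀‖) * T ≤ 1) :
    ∃ η : C(Set.Icc (0 : ℝ) T, Hs s), IsSolution γ₁ γ₂ δ₁ δ₂ γ hT η₀ η ∧
      ∀ t, ‖η t‖ ≤ 2 * ‖η₀‖ := by
  have hφ := measurable_phase γ₁ γ₂ δ₁ δ₂
  obtain ⟨v, h0, hb, hv⟩ := exists_isFlow hφ hC hN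
    (exists_lipschitzOnWith_nonlinearity γ hs hγ₁ hδ₁) hT (Hs.hat s η₀)
    (by rwa [(Hs.hat s).norm_map])
  obtain ⟨η, hη⟩ := exists_profile_eq (s := s) hφ hT hv.continuousOn
  refine ⟨η, (isSolution_iff γ γ₂ δ₂ hs hγ₁ hδ₁ hT η₀ η).2 ⟨?_, fun t ht => ?_⟩, fun t => ?_⟩
  · apply (Hs.hat s).injective
    rw [← profile_zero hφ hT, hη (Set.left_mem_Icc.2 hT.le), h0]
  · have := (hv t ht).congr hη (hη ht)
    rwa [← hη ht] at this
  · rw [← norm_profile hφ hT, hη t.2, ← (Hs.hat s).norm_map η₀]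
    exact hb t

theorem IsSolution.isReal (hs : 1 ≤ s) (hγ₁ : 0 < γ₁) (hδ₁ : 0 < δ₁) {hT : 0 < T} {η₀ : Hs s}
    {η : C(Set.Icc (0 : ℝ) T, Hs s)} (hη : IsSolution γ₁ γ₂ δ₁ δ₂ γ hT η₀ η) (h₀ : IsReal η₀)
    (t : Set.Icc (0 : ℝ) T) : IsReal (η t) := by
  have hφ := measurable_phase γ₁ γ₂ δ₁ δ₂
  have hs0 : 0 ≤ s := by linarith
  rw [isReal_iff hs0] at h₀ ⊢
  obtain ⟨h0, h⟩ := (isSolution_iff γ γ₂ δ₂ hs hγ₁ hδ₁ hT η₀ η).1 hη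
  have h' := h.conjNeg_comp hφ (phase_neg γ₂ δ₂) (conjNeg_nonlinearity γ hs hγ₁ hδ₁)
  have e := h'.eqOn hφ (exists_lipschitzOnWith_nonlinearity γ hs hγ₁ hδ₁) h
    (by rw [profile_zero hφ, h0, h₀]) t.2
  rw [profile_coe hφ hT, conjNeg_propagator hφ (phase_neg γ₂ δ₂)]
  exact congrArg _ e

/-- Grönwall for the profiles. The propagator at a fixed time is an isometry, so the distance of
profiles at t is the distance of solutions at t. -/
theorem exists_lipschitzOnWith_solution (γ : ℝ) (hs : 1 ≤ s) (hγ₁ : 0 < γ₁) (hδ₁ : 0 < δ₁)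
    (hT : 0 < T) (γ₂ δ₂ R : ℝ) :
    ∃ L : NNReal, ∀ η₀ ζ₀ : Hs s, ∀ η ζ : C(Set.Icc (0 : ℝ) T, Hs s),
      IsSolution γ₁ γ₂ δ₁ δ₂ γ hT η₀ η → IsSolution γ₁ γ₂ δ₁ δ₂ γ hT ζ₀ ζ →
      (∀ t, ‖η t‖ ≤ R) → (∀ t, ‖ζ t‖ ≤ R) → dist η ζ ≤ L * dist η₀ ζ₀ := by
  have hφ := measurable_phase γ₁ γ₂ δ₁ δ₂
  obtain ⟨K, hK⟩ := exists_lipschitzOnWith_nonlinearity γ hs hγ₁ hδ₁ R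
  refine ⟨(Real.exp (K * T)).toNNReal, fun η₀ ζ₀ η ζ hη hζ hηR hζR => ?_⟩
  rw [Real.coe_toNNReal _ (Real.exp_pos _).le]
  obtain ⟨h0, h⟩ := (isSolution_iff γ γ₂ δ₂ hs hγ₁ hδ₁ hT η₀ η).1 hη
  obtain ⟨k0, k⟩ := (isSolution_iff γ γ₂ δ₂ hs hγ₁ hδ₁ hT ζ₀ ζ).1 hζ
  rw [ContinuousMap.dist_le (by positivity)]
  intro t
  have := h.dist_le hφ hK k (fun t ht => (norm_profile hφ hT η ⟨t, ht⟩).trans_le (hηR _))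
    (fun t ht => (norm_profile hφ hT ζ ⟨t, ht⟩).trans_le (hζR _)) t t.2
  rw [profile_zero hφ, profile_zero hφ, h0, k0, (Hs.hat s).dist_map] at this
  rw [← (Hs.hat s).dist_map, profile_coe hφ, profile_coe hφ hT ζ, dist_eq_norm, ← map_sub,
    norm_propagator hφ, ← dist_eq_norm, mul_comm]
  exact this

end FifthOrderBBM

end

/-! ### The local well-posedness theorem -/

theorem theorem3p1 (s γ₁ δ₁ γ : ℝ) (hs : 1 ≤ s) (hγ₁ : 0 < γ₁) (hδ₁ : 0 < δ₁) :
    ∃ C : ℝ, 0 < C ∧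
      ∀ (γ₂ δ₂ : ℝ) (η₀ : FifthOrderBBM.Hs s) (T : ℝ) (hT : 0 < T),
        8 * C * ‖η₀‖ * (1 + ‖η₀‖) * T ≤ 1 →
          -- existence and uniqueness on `[0,T]`
          (∃! η : C(Set.Icc (0 : ℝ) T, FifthOrderBBM.Hs s),
            FifthOrderBBM.IsSolution γ₁ γ₂ δ₁ δ₂ γ hT η₀ η) ∧
          -- growth bound, and real data have real solutions
          (∀ η : C(Set.Icc (0 : ℝ) T, FifthOrderBBM.Hs s),
            FifthOrderBBM.IsSolution γ₁ γ₂ δ₁ δ₂ γ hT η₀ η →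
              (∀ t, ‖η t‖ ≤ 2 * ‖η₀‖) ∧
              (FifthOrderBBM.IsReal η₀ → ∀ t, FifthOrderBBM.IsReal (η t))) ∧
          -- near `η₀` there is a solution map into `C([0,T]; H^s)`, and it is continuous
          (∃ U ∈ 𝓝 η₀, ∃ Φ : FifthOrderBBM.Hs s → C(Set.Icc (0 : ℝ) T, FifthOrderBBM.Hs s),
            (∀ ζ₀ ∈ U, ∀ ζ : C(Set.Icc (0 : ℝ) T, FifthOrderBBM.Hs s),
              FifthOrderBBM.IsSolution γ₁ γ₂ δ₁ δ₂ γ hT ζ₀ ζ ↔ ζ = Φ ζ₀) ∧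
            ContinuousOn Φ U) := by
  obtain ⟨C, hC, hN⟩ := FifthOrderBBM.exists_norm_nonlinearity_le γ hs hγ₁ hδ₁
  -- Doubling the constant makes the smallness condition strict for `C`. It then persists for nearby
  -- data with the same T.
  refine ⟨2 * C, by positivity, fun γ₂ δ₂ η₀ T hT h => ?_⟩
  have hex := FifthOrderBBM.exists_isSolution hC hs hγ₁ hδ₁ hN γ₂ δ₂ hT
  have h1 : 8 * C * ‖η₀‖ * (1 + ‖η₀‖) * T < 1 := by linarith
  obtain ⟨η, hη, hηb⟩ := hex η₀ h1.le
  refine ⟨⟨η, hη, fun ζ hζ => hζ.eq hs hγ₁ hδ₁ hη⟩, fun ζ hζ => ?_, ?_⟩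
  · rw [hζ.eq hs hγ₁ hδ₁ hη]
    exact ⟨hηb, fun h₀ t => hη.isReal hs hγ₁ hδ₁ h₀ t⟩
  · choose! Φ hΦ hΦb using hex
    have hU : IsOpen {ζ : FifthOrderBBM.Hs s | 8 * C * ‖ζ‖ * (1 + ‖ζ‖) * T < 1} :=
      isOpen_lt (by fun_prop) continuous_const
    -- The unit ball bounds all these solutions by 2(‖η₀‖ + 1), so a single Lipschitz constant
    -- serves the whole neighbourhood.
    refine ⟨_, (hU.inter (Metric.isOpen_ball (x := η₀) (ε := 1))).mem_nhds
      ⟨h1, Metric.mem_ball_self one_pos⟩, Φ, ?_, ?_⟩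
    · intro ζ₀ hζ₀ ζ
      have hs₀ := hΦ ζ₀ hζ₀.1.le
      exact ⟨fun hζ => hζ.eq hs hγ₁ hδ₁ hs₀, fun hζ => hζ ▸ hs₀⟩
    · obtain ⟨L, hL⟩ := FifthOrderBBM.exists_lipschitzOnWith_solution γ hs hγ₁ hδ₁ hT γ₂ δ₂
        (2 * (‖η₀‖ + 1))
      have hb : ∀ ζ₀ ∈ {ζ : FifthOrderBBM.Hs s | 8 * C * ‖ζ‖ * (1 + ‖ζ‖) * T < 1} ∩
          Metric.ball η₀ 1, ∀ t, ‖Φ ζ₀ t‖ ≤ 2 * (‖η₀‖ + 1) := by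
        intro ζ₀ hζ₀ t
        have h2 := hζ₀.2
        rw [Metric.mem_ball, dist_eq_norm] at h2
        have := norm_le_norm_add_norm_sub' ζ₀ η₀
        linarith [hΦb ζ₀ hζ₀.1.le t]
      exact (LipschitzOnWith.of_dist_le_mul fun x hx y hy => hL x y _ _ (hΦ x hx.1.le)
        (hΦ y hy.1.le) (hb x hx) (hb y hy)).continuousOn
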